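/- Let $d\ge 1$. A finite plane tree $T$ with $|T|$ vertices has weight $\mathbb P(T)=\prod_{i\in T}\frac{e^{-1}}{\xi_i!}$, where $\xi_i$ is the number of offspring of the vertex $i$ (critical Poisson branching). An embedding $\varphi$ of $T$ into $\mathbb Z^d$ maps the root to the origin and adjacent vertices to nearest neighbours, and $\mathbb P(T,\varphi)=(2d)^{-(|T|-1)}\,\mathbb P(T)$. Let $m\ge 2$. An $m$-shape $\sigma$ is a tree with $m$ external vertices of degree $1$, labelled $0,1,\dots,m-1$, with $m-2$ unlabelled internal vertices of degree $3$ and no other vertices, together with a labelling of its $2m-3$ edges by $1,\dots,2m-3$; its edges are oriented away from vertex $0$. For $\bar i=(i_1,\dots,i_{m-1})\in T^{m-1}$ the backbone of $(T,\bar i)$ is the subtree of $T$ spanning the root and $i_1,\dots,i_{m-1}$. For $\vec y=(y_1,\dots,y_{2m-3})$ with $y_j\in\mathbb Z^d$ and $\vec s=(s_1,\dots,s_{2m-3})$ with $s_j\in\{0,1,2,\dots\}$, the triple $(T,\varphi,\bar i)$ is compatible with $(\sigma;\vec y,\vec s)$ if the backbone can be obtained from $\sigma$ by replacing each edge $j$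 by a path of length $s_j$ (contracting it to a point if $s_j=0$), with vertex $0$ of $\sigma$ corresponding to the root and vertex $l$ to $i_l$ for $1\le l\le m-1$, in such a way that for each $j$ the image under $\varphi$ of the path of edge $j$ (oriented away from the root) has displacement $y_j$. The $m$-point function and its Fourier transform are $$t_n^{(m)}(\sigma;\vec y,\vec s)=\sum_{(T,\varphi):|T|=n}\mathbb P(T,\varphi)\sum_{i_1,\dots,i_{m-1}\in T}I\big[(T,\varphi,\bar i)\text{ is compatible with }(\sigma;\vec y,\vec s)\big],$$ $$\hat t_n^{(m)}(\sigma;\vec k,\vec s)=\sum_{y_1,\dots,y_{2m-3}\in\mathbb Z^d}t_n^{(m)}(\sigma;\vec y,\vec s)\,e^{i\sum_j k_j\cdot y_j}\qquad(k_j\in\mathbb R^d).$$ For $k_j\in\mathbb R^d$ and $u_j\in[0,\infty)$ let $$\hat a^{(m)}(\sigma;\vec k,\vec u)=\Big(\sum_{j=1}^{2m-3}u_j\Big)e^{-\left(\sum_{j=1}^{2m-3}u_j\right)^2/2}\prod_{j=1}^{2m-3}e^{-|k_j|^2u_j/2}.$$ **Lemma 4.2.** For all $d\ge1$, $m\ge2$,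 every $m$-shape $\sigma$, all $\vec k=(k_1,\dots,k_{2m-3})$ with $k_j\in\mathbb R^d$ and all $\vec u=(u_1,\dots,u_{2m-3})$ with $u_j\in[0,\infty)$, $$\lim_{n\to\infty}n\,\hat t_n^{(m)}\big(\sigma;\vec k\,d^{1/2}n^{-1/4},\lfloor\vec u\,n^{1/2}\rfloor\big)=\frac1{\sqrt{2\pi}}\,\hat a^{(m)}(\sigma;\vec k,\vec u),$$ where $\lfloor\vec u\,n^{1/2}\rfloor$ has components $\lfloor u_jn^{1/2}\rfloor$. Moreover, if $\vec u\ne\vec 0$ (so that the right side is not zero), then $$\hat t_n^{(m)}\big(\sigma;\vec k\,d^{1/2}n^{-1/4},\lfloor\vec u\,n^{1/2}\rfloor\big)\sim\frac1{\sqrt{2\pi}}\,\frac1n\,\hat a^{(m)}(\sigma;\vec k,\vec u)\qquad(n\to\infty),$$ where $f(n)\sim g(n)$ means $\lim_{n\to\infty}f(n)/g(n)=1$. -/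

import Mathlib

namespace MeanFieldTree

noncomputable section

/-- A finite plane tree, described by its set of words. The root is the empty word, and the
children of the vertex `w` are the words `w ++ [0], ..., w ++ [ξ - 1]`, where `ξ` is the number of
offspring of `w`. -/
structure PlaneTree where
  words : Finset (List ℕ)
  root_mem : [] ∈ words
  parent_mem : ∀ (w : List ℕ) (a : ℕ), w ++ [a] ∈ words → w ∈ words
  sibling_mem : ∀ (w : List ℕ) (a : ℕ), w ++ [a + 1] ∈ words → w ++ [a] ∈ words

namespace PlaneTree

/-- The vertices of a plane tree. -/
abbrev Vertex (T : PlaneTree) : Type := {w : List ℕ // w ∈ T.words}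

/-- The root of a plane tree. -/
def root (T : PlaneTree) : T.Vertex := ⟨[], T.root_mem⟩

/-- The number of vertices `|T|`. -/
def size (T : PlaneTree) : ℕ := T.words.card

/-- The number `ξ` of offspring of the vertex `w`. -/
def offspring (T : PlaneTree) (w : List ℕ) : ℕ := {a : ℕ | w ++ [a] ∈ T.words}.ncard

/-- The weight of `T` as the family tree of the critical birth process with Poisson offspring
distribution of mean `1`. -/
def weight (T : PlaneTree) : ℝ :=
  ∏ w ∈ T.words, Real.exp (-1) / (Nat.factorial (T.offspring w) : ℝ)

/-- An embedding of `T` into `ℤ^d`: the root goes to the origin and adjacent vertices go to nearest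
neighbours (it need not be injective). -/
structure Embedding (T : PlaneTree) (d : ℕ) where
  pos : T.Vertex → Fin d → ℤ
  pos_root : pos T.root = 0
  pos_adj : ∀ (v w : T.Vertex) (a : ℕ), w.1 = v.1 ++ [a] → ∑ i, |pos w i - pos v i| = 1

/-- The probability of the configuration `(T, φ)`: each of the `(2d)^(|T|-1)` embeddings of `T` is
equally likely. -/
def configWeight (T : PlaneTree) (d : ℕ) : ℝ :=
  T.weight / (2 * (d : ℝ)) ^ (T.size - 1)

/-- The vertex set of the backbone of `(T, i)`, the subtree spanning the root and the `i l`: it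
consists of the root and of all the `i l` and their ancestors. -/
def backbone (T : PlaneTree) {r : ℕ} (i : Fin r → T.Vertex) : Set T.Vertex :=
  {w | w = T.root ∨ ∃ l, w.1 <+: (i l).1}

/-- The vertices other than `v` on the path of `T` from `v` to its descendant `w`. They correspond
to the bonds of that path, a bond being identified with its endpoint farther from the root. -/
def pathBonds (T : PlaneTree) (v w : T.Vertex) : Set T.Vertex :=
  {x | v.1 <+: x.1 ∧ x ≠ v ∧ x.1 <+: w.1}

end PlaneTree

/-- The vertices of an `m`-shape: the external vertex `0` (`root`), the external vertices
`1, ..., m - 1` (`leaf`), and `m - 2` internal vertices. -/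
inductive ShapeVertex (m : ℕ) : Type
  | root : ShapeVertex m
  | leaf : Fin (m - 1) → ShapeVertex m
  | internal : Fin (m - 2) → ShapeVertex m

/-- An `m`-shape (for `m ≥ 2`): a tree whose external vertices have degree `1` and whose internal
vertices have degree `3`, with a labelling of its `2m - 3` edges. The names of the internal vertices
carry no information; a shape is represented here by any choice of them. -/
structure Shape (m : ℕ) where
  graph : SimpleGraph (ShapeVertex m)
  isTree : graph.IsTree
  degree_root : (graph.neighborSet ShapeVertex.root).ncard = 1
  degree_leaf : ∀ l, (graph.neighborSet (ShapeVertex.leaf l)).ncard = 1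
  degree_internal : ∀ v, (graph.neighborSet (ShapeVertex.internal v)).ncard = 3
  edge : Fin (2 * m - 3) ≃ graph.edgeSet

/-- The edge of `σ` with label `j`, oriented away from vertex `0`, goes from `a` to `b`. -/
def Shape.IsEdge {m : ℕ} (σ : Shape m) (j : Fin (2 * m - 3)) (a b : ShapeVertex m) : Prop :=
  (σ.edge j : Sym2 (ShapeVertex m)) = s(a, b) ∧
    σ.graph.dist ShapeVertex.root b = σ.graph.dist ShapeVertex.root a + 1

/-- `(T, φ, i)` is compatible with `(σ; y, s)`. The map `f` exhibits the backbone of `(T, i)` as the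
shape `σ` with edge `j` replaced by a path of length `s j` (contracted to a point if `s j = 0`), so
that every bond of the backbone belongs to the path of exactly one edge of `σ`, and the image under
`φ` of the path of edge `j` has displacement `y j`. -/
def Compatible {d m : ℕ} (T : PlaneTree) (φ : T.Embedding d) (i : Fin (m - 1) → T.Vertex)
    (σ : Shape m) (y : Fin (2 * m - 3) → Fin d → ℤ) (s : Fin (2 * m - 3) → ℕ) : Prop :=
  ∃ f : ShapeVertex m → T.Vertex,
    f ShapeVertex.root = T.root ∧
    (∀ l, f (ShapeVertex.leaf l) = i l) ∧
    (∀ j a b, σ.IsEdge j a b →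
      (f a).1 <+: (f b).1 ∧
      (f b).1.length = (f a).1.length + s j ∧
      φ.pos (f b) - φ.pos (f a) = y j) ∧
    (∀ w ∈ T.backbone i, w ≠ T.root →
      ∃! j, ∃ a b, σ.IsEdge j a b ∧ w ∈ T.pathBonds (f a) (f b))

open Classical in
/-- The `m`-point function `t_n^{(m)}(σ; y, s)`. There are finitely many plane trees with `n`
vertices and finitely many embeddings of each, so all sums are finite. -/
def mPoint (d m n : ℕ) (σ : Shape m) (y : Fin (2 * m - 3) → Fin d → ℤ)
    (s : Fin (2 * m - 3) → ℕ) : ℝ :=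
  ∑' T : {T : PlaneTree // T.size = n}, ∑' φ : T.1.Embedding d,
    T.1.configWeight d *
      ∑ i : Fin (m - 1) → T.1.Vertex, if Compatible T.1 φ i σ y s then (1 : ℝ) else 0

/-- The Fourier transform of `t_n^{(m)}(σ; y, s)` in `y`, at `k`. Only finitely many `y` contribute
to the sum. -/
def mPointFourier (d m n : ℕ) (σ : Shape m) (k : Fin (2 * m - 3) → EuclideanSpace ℝ (Fin d))
    (s : Fin (2 * m - 3) → ℕ) : ℂ :=
  ∑' y : Fin (2 * m - 3) → Fin d → ℤ,
    (mPoint d m n σ y s : ℂ) *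
      Complex.exp (Complex.I * ((∑ j, ∑ c, k j c * (y j c : ℝ) : ℝ) : ℂ))

/-- The function `â^{(m)}(σ; k, t)`, which takes the same value for all shapes `σ`. -/
def aHat {d m : ℕ} (k : Fin (2 * m - 3) → EuclideanSpace ℝ (Fin d))
    (t : Fin (2 * m - 3) → ℝ) : ℝ :=
  (∑ j, t j) * Real.exp (-(∑ j, t j) ^ 2 / 2) * ∏ j, Real.exp (-(‖k j‖ ^ 2 * t j) / 2)

/-- The Fourier transform `t̂_n^{(m)}(σ; k d^{1/2} n^{-1/4}, ⌊u n^{1/2}⌋)`. -/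
def scaledMPoint (d m n : ℕ) (σ : Shape m) (k : Fin (2 * m - 3) → EuclideanSpace ℝ (Fin d))
    (u : Fin (2 * m - 3) → ℝ) : ℂ :=
  mPointFourier d m n σ
    (fun j => (Real.sqrt (d : ℝ) * (n : ℝ) ^ (-(1 / 4) : ℝ)) • k j)
    (fun j => ⌊u j * Real.sqrt (n : ℝ)⌋₊)

end

end MeanFieldTree

namespace MeanFieldTree

/-! The limit comes from an exact formula. A compatible choice of marked vertices is the same thing
as a copy, sitting at the root of `T`, of the tree `B` obtained from the shape by subdividing edge
`j` into `s j` bonds; `B` has `b = ∑ s j + 1` vertices. A uniform embedding makes independent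
uniform nearest-neighbour steps along the bonds of `T`, so the Fourier transform factors into the
weighted number of copies of `B` in trees of size `n` and `∏ stepChar (k j) ^ s j`
(`mPointFourier_eq`).

The copies are counted by labelling the vertices. A labelled plane tree is a rooted labelled tree
with an order on the children of each vertex, and the number `∏ ξ!` of such orders cancels the
factorials in the Poisson weight; hence all rooted labelled trees carry the same weight `e⁻ⁿ / n!`
(`factorial_mul_sum_weight`). The labelled trees containing a given copy of `B` are the forests
whose roots are the `b` vertices of that copy, and Cayley's formula `card_forest` counts `b
n^(n-b-1)` of them (`card_tree_embeddings`). The result depends on `B` only through `b`, which is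
why the limit is the same for all shapes: `n * copyWeight = (b / √n) * ((n)_b / n^b) * (√n (n/e)^n /
n!)` for `b ≤ n`, where `(n)_b` is the falling factorial (`copyWeight_eq`).

With `s j = ⌊u j √n⌋` and `U = ∑ u j`, the three factors tend to `U`, `exp (-U² / 2)` and `1 /
√(2π)` (Stirling). At the scaled frequency `stepChar` is `1 - |k j|² / (2√n)` to leading order, so
its power tends to `exp (-|k j|² u j / 2)`. -/

/-! ### Forests as parent maps and Cayley's formula -/

/-- `p` has no nonempty invariant subset of `A`: iterating `p` from any point of `A` leads to `R`,
so `p` is the parent map of a forest on `A ⊕ R` with set of roots `R`. -/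
def IsForest {A R : Type} (p : A → A ⊕ R) : Prop :=
  ∀ S : Set A, S.Nonempty → ∃ a ∈ S, ∀ b ∈ S, p a ≠ Sum.inl b

/-- A forest is given by the set `S` of children of the roots, the parents of the elements of `S`,
and a forest with set of roots `S`. -/
noncomputable def forestEquiv (A R : Type) :
    {p : A → A ⊕ R // IsForest p} ≃
      Σ S : Set A, (S → R) × {p : ↥Sᶜ → ↥Sᶜ ⊕ S // IsForest p} := by
  classical
  refine Equiv.symm (Equiv.ofBijective
    (fun x => ⟨fun a => if h : a ∈ x.1 then Sum.inr (x.2.1 ⟨a, h⟩) else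
      Sum.inl (Sum.elim Subtype.val Subtype.val (x.2.2.1 ⟨a, h⟩)), ?_⟩) ⟨?_, ?_⟩)
  · obtain ⟨S, u, q, hq⟩ := x
    intro Z hZ
    by_cases hS : ∃ a ∈ Z, a ∈ S
    · obtain ⟨a, ha, haS⟩ := hS
      exact ⟨a, ha, by simp [haS]⟩
    · push Not at hS
      obtain ⟨a, ha, hb⟩ := hq (Subtype.val ⁻¹' Z) (by
        obtain ⟨a, ha⟩ := hZ
        exact ⟨⟨a, hS a ha⟩, ha⟩)
      refine ⟨a, ha, fun b hbZ => ?_⟩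
      have haS : a.1 ∉ S := a.2
      simp only [haS, dite_false, ne_eq, Sum.inl.injEq]
      intro h
      rcases hqa : q a with c | c
      · simp only [Subtype.coe_eta, hqa, Sum.elim_inl] at h
        exact hb c (by simpa [h] using hbZ) hqa
      · simp only [Subtype.coe_eta, hqa, Sum.elim_inr] at h
        exact hS b hbZ (h ▸ c.2)
  · rintro ⟨S, u, q, hq⟩ ⟨S', u', q', hq'⟩ h
    have h' := congrArg Subtype.val h
    have hS : S = S' := by
      ext a
      have := congrFun h' a
      by_cases h1 : a ∈ S <;> by_cases h2 : a ∈ S' <;> simp_all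
    subst hS
    have hu : u = u' := by
      ext ⟨a, ha⟩
      have := congrFun h' a
      simpa [ha] using this
    have hqq : q = q' := by
      ext1 ⟨a, ha⟩
      have haS : a ∉ S := ha
      have := congrFun h' a
      simp only [haS, dite_false, Sum.inl.injEq] at this
      rcases h1 : q ⟨a, ha⟩ with c | c <;> rcases h2 : q' ⟨a, ha⟩ with c' | c' <;>
        simp only [h1, h2, Sum.elim_inl, Sum.elim_inr] at this
      · rw [Subtype.ext this]
      · exact absurd (this ▸ c'.2) c.2
      · exact absurd (this ▸ c.2) c'.2
      · rw [Subtype.ext this]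
    subst hu hqq
    rfl
  · rintro ⟨p, hp⟩
    let S : Set A := {a | ∃ r, p a = Sum.inr r}
    have hl : ∀ a : ↥Sᶜ, ∃ b, p a = Sum.inl b := by
      rintro ⟨a, ha⟩
      rcases h : p a with b | b
      · exact ⟨b, rfl⟩
      · exact absurd ⟨b, h⟩ ha
    choose u hu using fun a : S => a.2
    choose v hv using hl
    refine ⟨⟨S, u, ⟨fun a => if h : v a ∈ S then Sum.inr ⟨v a, h⟩ else Sum.inl ⟨v a, h⟩, ?_⟩⟩, ?_⟩
    · intro Z hZ
      obtain ⟨_, ⟨a, ha, rfl⟩, hb⟩ := hp (Subtype.val '' Z) (hZ.image _)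
      refine ⟨a, ha, fun b hbZ h => hb b ⟨b, hbZ, rfl⟩ ?_⟩
      rw [hv]
      dsimp only at h
      split_ifs at h with hva
      rw [← Sum.inl.inj h]
    · ext1
      funext a
      by_cases h : a ∈ S
      · simp only [h, dite_true]
        exact (hu ⟨a, h⟩).symm
      · simp only [h, dite_false]
        rw [hv ⟨a, h⟩]
        split_ifs <;> simp

instance {A R : Type} [Finite A] [Finite R] : Finite {p : A → A ⊕ R // IsForest p} :=
  Subtype.finite

/-- Group by `k = |S|`, absorb `k * choose a k = a * choose (a - 1) (k - 1)`, and recognise the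
binomial expansion of `(r + a) ^ (a - 1)`. The sum is the recursion for `card_forest` over the set
`S` of children of the roots. -/
theorem sum_powerset_forest (A : Type) [Fintype A] (r : ℕ) :
    (∑ S : Finset A, r ^ S.card * (S.card * Fintype.card A ^ (Fintype.card A - S.card)))
      = Fintype.card A * r * (Fintype.card A + r) ^ (Fintype.card A - 1) := by
  classical
  rw [← Finset.powerset_univ,
    Finset.sum_powerset_apply_card
      (fun k => r ^ k * (k * Fintype.card A ^ (Fintype.card A - k)))]
  rw [Finset.card_univ]
  generalize Fintype.card A = a
  cases a with
  | zero => simp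
  | succ a =>
    rw [Finset.sum_range_succ', add_comm (a + 1) r, add_tsub_cancel_right a 1, add_pow r (a + 1) a,
      Finset.mul_sum]
    simp only [smul_eq_mul, zero_mul, mul_zero, add_zero,
      Nat.add_sub_add_right]
    refine Finset.sum_congr rfl fun k hk => ?_
    have := Nat.add_one_mul_choose_eq a k
    rw [pow_succ r]
    calc _ = (a + 1).choose (k + 1) * (k + 1) * (r ^ k * r * (a + 1) ^ (a - k)) := by ring
      _ = _ := by rw [← this]; push_cast; ring

/-- Cayley's formula: there are `r (a + r) ^ (a - 1)` forests with `r` given roots and `a` other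
vertices. -/
theorem card_forest (A R : Type) [Finite A] [Finite R] :
    Nat.card {p : A → A ⊕ R // IsForest p} * (Nat.card A + Nat.card R) =
      Nat.card R * (Nat.card A + Nat.card R) ^ Nat.card A := by
  classical
  induction hn : Nat.card A using Nat.strong_induction_on generalizing A R with
  | _ n ih =>
  rcases Nat.eq_zero_or_pos n with rfl | hpos
  · have : IsEmpty A := by simpa [Nat.card_eq_zero, not_infinite_iff_finite.2 ‹Finite A›] using hn
    have : Nat.card {p : A → A ⊕ R // IsForest p} = 1 := by
      rw [Nat.card_eq_one_iff_unique]
      refine ⟨inferInstance, ⟨⟨fun a => isEmptyElim a, fun S hS => ?_⟩⟩⟩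
      obtain ⟨a, -⟩ := hS
      exact isEmptyElim a
    rw [this]; simp
  have := Fintype.ofFinite A
  have hcA : Fintype.card A = n := by rw [← hn, Nat.card_eq_fintype_card]
  -- The extra factor `n` raises the exponent `n - |S| - 1` of the inductive count to `n - |S|`, so
  -- truncated subtraction does no harm.
  have key : Nat.card {p : A → A ⊕ R // IsForest p} * n =
      ∑ S : Finset A, Nat.card R ^ S.card *
        (S.card * Fintype.card A ^ (Fintype.card A - S.card)) := by
    rw [Nat.card_congr (forestEquiv A R), Nat.card_sigma, Finset.sum_mul,
      ← Fintype.sum_equiv (Fintype.finsetEquivSet (α := A))]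
    intro S
    have hS : Nat.card ↥(S : Set A) = S.card := by simp
    have hSc : Nat.card ↥((S : Set A)ᶜ) = n - S.card := by
      rw [← hcA, ← Finset.card_compl, ← Finset.coe_compl]
      exact Set.ncard_coe_finset _
    rw [Fintype.coe_finsetEquivSet, Nat.card_prod, Nat.card_fun, hS, hcA, mul_assoc]
    congr 1
    have hle : S.card ≤ n := hcA ▸ Finset.card_le_univ S
    rcases S.eq_empty_or_nonempty with rfl | hne
    -- If no vertex is a child of a root, the whole nonempty set of vertices is invariant, so there
    -- is no forest.
    · have : IsEmpty {p : ↥((∅ : Finset A) : Set A)ᶜ →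
          ↥((∅ : Finset A) : Set A)ᶜ ⊕ ↥((∅ : Finset A) : Set A) // IsForest p} := by
        refine ⟨fun ⟨p, hp⟩ => ?_⟩
        have : Nonempty A := Fintype.card_pos_iff.1 (hcA ▸ hpos)
        obtain ⟨x⟩ := this
        obtain ⟨a, -, h⟩ := hp Set.univ ⟨⟨x, by simp⟩, trivial⟩
        rcases hpa : p a with b | b
        · exact h b trivial hpa
        · simpa using b.2
      simp
    · have hc := hne.card_pos
      have := ih _ (by omega) (↥((S : Set A)ᶜ)) (↥(S : Set A)) hSc
      rw [hS, Nat.sub_add_cancel hle] at this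
      exact this.symm
  rw [sum_powerset_forest, hcA] at key
  have h2 : Nat.card {p : A → A ⊕ R // IsForest p} =
      Nat.card R * (n + Nat.card R) ^ (n - 1) := by
    apply Nat.eq_of_mul_eq_mul_right hpos
    rw [key]; ring
  rw [h2, mul_assoc, ← pow_succ, Nat.sub_add_cancel hpos]

/-! ### Rooted trees containing a copy of a given tree -/

/-- `p` is the parent map of a tree on `V` with root `r`, where the root is its own parent. -/
structure IsRootedTree {V : Type} (p : V → V) (r : V) : Prop where
  map_root : p r = r
  root_mem : ∀ S : Set V, S.Nonempty → (∀ v ∈ S, p v ∈ S) → r ∈ S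

/-- The embedding `h` preserves roots and parents. -/
def IsTreeEmb {B V : Type} (pB : B → B) (b₀ : B) (p : V → V) (r : V) (h : B ↪ V) : Prop :=
  h b₀ = r ∧ ∀ β, p (h β) = h (pB β)

/-- The rooted trees on `V` that contain a given copy of the rooted tree `B` correspond to the
forests whose roots are the vertices of that copy. -/
noncomputable def extensionEquiv {B V : Type} {pB : B → B} {b₀ : B} (hB : IsRootedTree pB b₀)
    (h : B ↪ V) :
    {q : ↥(Set.range h)ᶜ → ↥(Set.range h)ᶜ ⊕ Set.range h // IsForest q} ≃
      {t : (V → V) × V // IsRootedTree t.1 t.2 ∧ IsTreeEmb pB b₀ t.1 t.2 h} := by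
  classical
  let e : ↥(Set.range h)ᶜ ⊕ Set.range h ≃ V :=
    (Equiv.sumComm _ _).trans (Equiv.Set.sumCompl (Set.range h))
  let P : (↥(Set.range h)ᶜ → ↥(Set.range h)ᶜ ⊕ Set.range h) → V → V := fun q v =>
    if hv : v ∈ Set.range h then h (pB hv.choose) else e (q ⟨v, hv⟩)
  have P1 : ∀ q β, P q (h β) = h (pB β) := fun q β => by
    have hv : h β ∈ Set.range h := ⟨β, rfl⟩
    simp only [P, hv, dite_true]
    rw [h.injective hv.choose_spec]
  have P2 : ∀ q v (hv : v ∉ Set.range h), P q v = e (q ⟨v, hv⟩) := fun q v hv => by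
    simp only [P, hv, dite_false]
  have root : ∀ (p : V → V), (∀ β, p (h β) = h (pB β)) → ∀ S : Set V, (∀ v ∈ S, p v ∈ S) →
      (∃ β, h β ∈ S) → h b₀ ∈ S := fun p hp S hS hβ =>
    hB.root_mem (h ⁻¹' S) hβ fun β hβ => by
      simpa [hp] using hS _ hβ
  refine Equiv.ofBijective (fun q => ⟨(P q.1, h b₀), ⟨?_, ?_⟩, rfl, P1 q.1⟩) ⟨?_, ?_⟩
  · exact (P1 _ _).trans (by rw [hB.map_root])
  · intro S hne hS
    by_cases hβ : ∃ β, h β ∈ S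
    · exact root _ (P1 q.1) S hS hβ
    -- A closed set missing the copy would be an invariant set of the forest.
    · exfalso
      have hnot : ∀ v ∈ S, v ∉ Set.range h := by
        rintro _ hv ⟨β, rfl⟩
        exact hβ ⟨β, hv⟩
      obtain ⟨v, hv⟩ := hne
      obtain ⟨a, haS, ha⟩ := q.2 (Subtype.val ⁻¹' S) ⟨⟨v, hnot v hv⟩, hv⟩
      have h2 : P q.1 a ∈ S := hS _ haS
      have h3 := P2 q.1 a a.2
      rcases h4 : q.1 a with b | b
      · have : P q.1 a = b := by rw [h3, Subtype.coe_eta, h4]; rfl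
        exact ha b (show b.1 ∈ S from this ▸ h2) h4
      · have : P q.1 a = b := by rw [h3, Subtype.coe_eta, h4]; rfl
        exact hnot _ (this ▸ h2) b.2
  · intro q q' hqq
    have h1 : P q.1 = P q'.1 := congrArg (fun t => t.1.1) hqq
    ext1
    funext a
    apply e.injective
    have := congrFun h1 a.1
    rwa [P2 q.1 a.1 a.2, P2 q'.1 a.1 a.2] at this
  · rintro ⟨⟨p, r⟩, hT, hr, hp⟩
    dsimp only at hT hr hp
    subst hr
    refine ⟨⟨fun a => e.symm (p a), ?_⟩, ?_⟩
    · rintro S ⟨a, ha⟩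
      by_contra hcon
      push Not at hcon
      -- An invariant set outside the copy would be closed under `p` and so contain the root, which
      -- lies in the copy.
      obtain ⟨⟨b, hb⟩, -, h2⟩ := hT.root_mem (Subtype.val '' S) ⟨a, a, ha, rfl⟩ (by
        rintro _ ⟨c, hc, rfl⟩
        obtain ⟨b, hb, h3⟩ := hcon c hc
        refine ⟨b, hb, ?_⟩
        rw [Equiv.symm_apply_eq] at h3
        rw [h3]; rfl)
      exact hb ⟨b₀, h2.symm⟩
    · ext1
      ext1
      · funext v
        by_cases hv : v ∈ Set.range h
        · obtain ⟨β, rfl⟩ := hv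
          exact (P1 _ β).trans (hp β).symm
        · exact (P2 _ v hv).trans (by simp)
      · rfl

/-- For each of the `descFactorial` many placements `h`, Cayley's formula counts the forests rooted
at the range of `h`. The factor `Nat.card V` on the left again replaces an exponent lowered by one.
-/
theorem card_tree_embeddings {B V : Type} [Finite B] [Finite V] {pB : B → B} {b₀ : B}
    (hB : IsRootedTree pB b₀) :
    Nat.card (Σ h : B ↪ V, {t : (V → V) × V // IsRootedTree t.1 t.2 ∧
      IsTreeEmb pB b₀ t.1 t.2 h}) * Nat.card V =
      (Nat.card V).descFactorial (Nat.card B) *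
        (Nat.card B * Nat.card V ^ (Nat.card V - Nat.card B)) := by
  classical
  have := Fintype.ofFinite B
  have := Fintype.ofFinite V
  have key : ∀ h : B ↪ V, Nat.card {t : (V → V) × V // IsRootedTree t.1 t.2 ∧
      IsTreeEmb pB b₀ t.1 t.2 h} * Nat.card V =
        Nat.card B * Nat.card V ^ (Nat.card V - Nat.card B) := by
    intro h
    have h1 : Nat.card (Set.range h) = Nat.card B :=
      (Nat.card_congr (Equiv.ofInjective h h.injective)).symm
    have h2 : Nat.card ↥(Set.range h)ᶜ + Nat.card (Set.range h) = Nat.card V := by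
      rw [add_comm]; exact Set.ncard_add_ncard_compl _
    have h3 := card_forest ↥(Set.range h)ᶜ (Set.range h)
    rw [h2, h1, Nat.card_congr (extensionEquiv hB h)] at h3
    rw [h3]
    congr
    omega
  rw [Nat.card_sigma, Finset.sum_mul, Finset.sum_congr rfl fun h _ => key h, Finset.sum_const,
    smul_eq_mul, Finset.card_univ, Fintype.card_embedding_eq, Nat.card_eq_fintype_card,
    Nat.card_eq_fintype_card]

namespace IsRootedTree

variable {V : Type} {p : V → V} {r : V}

theorem induction (h : IsRootedTree p r) {P : V → Prop} (hr : P r)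
    (hp : ∀ v, v ≠ r → P (p v) → P v) (v : V) : P v := by
  by_contra hv
  refine h.root_mem {v | ¬ P v} ⟨v, hv⟩ (fun w hw hpw => ?_) hr
  by_cases hwr : w = r
  · rw [hwr] at hw
    exact hw hr
  · exact hw (hp w hwr hpw)

theorem exists_iterate (h : IsRootedTree p r) (v : V) : ∃ k, p^[k] v = r :=
  h.induction (P := fun v => ∃ k, p^[k] v = r) ⟨0, rfl⟩ (fun _ _ ⟨k, hk⟩ => ⟨k + 1, hk⟩) v

theorem transport {W : Type} (h : IsRootedTree p r) (e : V ≃ W) :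
    IsRootedTree (fun w => e (p (e.symm w))) (e r) := by
  refine ⟨by simp [h.map_root], fun S hS hpS => ?_⟩
  refine h.root_mem (e ⁻¹' S) (by obtain ⟨w, hw⟩ := hS; exact ⟨e.symm w, by simpa⟩)
    fun v hv => ?_
  simpa using hpS (e v) hv

/-- Recursion on the height, the first `k` with `p^[k] v = r`: for `v ≠ r` it exceeds the height of
the parent by exactly one. -/
theorem exists_rec (h : IsRootedTree p r) {X : Type} (x₀ : X) (G : V → X → X) :
    ∃ F : V → X, F r = x₀ ∧ ∀ v, v ≠ r → F v = G v (F (p v)) := by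
  classical
  let FN : ℕ → V → X := fun k => Nat.rec (fun _ => x₀) (fun _ f v => G v (f (p v))) k
  refine ⟨fun v => FN (Nat.find (h.exists_iterate v)) v, ?_, fun v hv => ?_⟩
  · have : Nat.find (h.exists_iterate r) = 0 := by simp
    simp only [this]
    rfl
  · have : Nat.find (h.exists_iterate v) = Nat.find (h.exists_iterate (p v)) + 1 :=
      Nat.find_comp_succ _ (h.exists_iterate (p v)) (by simpa using hv)
    simp only [this, FN]

end IsRootedTree

/-! ### Orderings of children, and plane trees as ordered labelled trees -/

/-- The children of `v` in the tree with parent map `p` and root `r`. -/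
def children {V : Type} (p : V → V) (r v : V) : Set V := {w | w ≠ r ∧ p w = v}

/-- `q` numbers the children of every vertex by consecutive integers from `0`. -/
structure IsOrdering {V : Type} (p : V → V) (r : V) (q : V → ℕ) : Prop where
  map_root : q r = 0
  bijOn : ∀ v, Set.BijOn q (children p r v) (Set.Iio (children p r v).ncard)

/-- An ordering is an independent choice, for each `v`, of a bijection from its children to `Fin`.
The root is a child of nobody, and pinning its value to `0` prevents it from being a free parameter.
These factorials later cancel those of the Poisson weights. -/
theorem card_ordering {V : Type} [Fintype V] (p : V → V) (r : V) :
    Nat.card {q : V → ℕ // IsOrdering p r q} = ∏ v, (children p r v).ncard.factorial := by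
  classical
  let F : ((v : V) → children p r v ≃ Fin (children p r v).ncard) → V → ℕ := fun e w =>
    if h : w = r then 0 else (e (p w) ⟨w, h, rfl⟩ : ℕ)
  have F1 : ∀ e v (w : children p r v), F e w.1 = e v w := by
    rintro e v ⟨w, hw, rfl⟩
    simp only [F, hw, dite_false]
  have : Function.Bijective (fun e => (⟨F e, by
      refine ⟨by simp [F], fun v => ⟨fun w hw => ?_, fun w hw w' hw' h => ?_, fun a ha => ?_⟩⟩
      · rw [F1 e v ⟨w, hw⟩]
        exact (e v ⟨w, hw⟩).2
      · rw [F1 e v ⟨w, hw⟩, F1 e v ⟨w', hw'⟩] at h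
        simpa using (e v).injective (Fin.ext h)
      · refine ⟨(e v).symm ⟨a, ha⟩, ((e v).symm ⟨a, ha⟩).2, ?_⟩
        rw [F1 e v]
        simp⟩ : {q : V → ℕ // IsOrdering p r q})) := by
    refine ⟨fun e e' h => ?_, fun ⟨q, hq⟩ => ?_⟩
    · funext v
      ext w
      rw [← F1, ← F1]
      exact congrFun (congrArg Subtype.val h) w.1
    · let e : (v : V) → children p r v ≃ Fin (children p r v).ncard := fun v =>
        Equiv.ofBijective (fun w => ⟨q w, (hq.bijOn v).mapsTo w.2⟩)
          ⟨fun w w' h => Subtype.ext ((hq.bijOn v).injOn w.2 w'.2 (congrArg Fin.val h)),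
            fun a => by
              obtain ⟨w, hw, hwa⟩ := (hq.bijOn v).surjOn a.2
              exact ⟨⟨w, hw⟩, Fin.ext hwa⟩⟩
      refine ⟨e, Subtype.ext (funext fun w => ?_)⟩
      by_cases h : w = r
      · simp [F, h, hq.map_root]
      · exact F1 e (p w) ⟨w, h, rfl⟩
  rw [← Nat.card_congr (Equiv.ofBijective _ this), Nat.card_pi]
  refine Finset.prod_congr rfl fun v _ => ?_
  have e : children p r v ≃ Fin (children p r v).ncard := Finite.equivFin _
  rw [Nat.card_congr (Equiv.equivCongr e (Equiv.refl _)), Nat.card_eq_fintype_card,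
    Fintype.card_equiv (Equiv.refl _), Fintype.card_fin]

theorem eq_Iio_ncard {S : Set ℕ} (hS : S.Finite) (h : ∀ a, a + 1 ∈ S → a ∈ S) :
    S = Set.Iio S.ncard := by
  have hd : ∀ a b, a ≤ b → b ∈ S → a ∈ S := fun a b hab hb => by
    induction b, hab using Nat.le_induction with
    | base => exact hb
    | succ b _ ih => exact ih (h b hb)
  obtain ⟨m, hm⟩ : ∃ m, m ∉ S := hS.exists_notMem
  classical
  have hex : ∃ m, m ∉ S := ⟨m, hm⟩
  have : S = Set.Iio (Nat.find hex) := by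
    ext a
    refine ⟨fun ha => ?_, fun ha => by simpa using Nat.find_min hex ha⟩
    by_contra hlt
    exact Nat.find_spec hex (hd _ _ (not_lt.1 hlt) ha)
  have h2 : S.ncard = Nat.find hex := by
    conv_lhs => rw [this]
    rw [← Finset.coe_Iio, Set.ncard_coe_finset]
    simp
  rwa [h2]

namespace PlaneTree

theorem words_injective : Function.Injective PlaneTree.words := by
  rintro ⟨⟩ ⟨⟩ h
  cases h
  rfl

theorem dropLast_mem (T : PlaneTree) (w : T.Vertex) : w.1.dropLast ∈ T.words := by
  obtain ⟨w, hw⟩ := w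
  rcases List.eq_nil_or_concat w with rfl | ⟨v, a, rfl⟩
  · exact hw
  · simpa using T.parent_mem v a (by simpa using hw)

/-- The parent of a vertex; the root is its own parent. -/
def parent (T : PlaneTree) (w : T.Vertex) : T.Vertex := ⟨w.1.dropLast, T.dropLast_mem w⟩

theorem isRootedTree (T : PlaneTree) : IsRootedTree T.parent T.root := by
  refine ⟨rfl, ?_⟩
  rintro S ⟨⟨w, hw⟩, hwS⟩ hS
  induction w using List.reverseRecOn with
  | nil => exact hwS
  | append_singleton v a ih =>
    refine ih (T.parent_mem v a hw) ?_
    have := hS _ hwS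
    simpa [parent] using this

theorem ne_root_iff (T : PlaneTree) (w : T.Vertex) :
    w ≠ T.root ↔ w.1 = (T.parent w).1 ++ [w.1.getLastD 0] := by
  obtain ⟨w, hw⟩ := w
  rcases List.eq_nil_or_concat w with rfl | ⟨v, a, rfl⟩
  · simp [root]
  · simp [root, parent, Subtype.ext_iff]

theorem bijOn_getLastD (T : PlaneTree) (v : T.Vertex) :
    Set.BijOn (fun w : T.Vertex => w.1.getLastD 0) (children T.parent T.root v)
      {a | v.1 ++ [a] ∈ T.words} := by
  refine ⟨fun w hw => ?_, fun w hw w' hw' h => ?_, fun a ha => ?_⟩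
  · have := (T.ne_root_iff w).1 hw.1
    rw [hw.2] at this
    change v.1 ++ [w.1.getLastD 0] ∈ T.words
    exact this ▸ w.2
  · have h1 := (T.ne_root_iff w).1 hw.1
    have h2 := (T.ne_root_iff w').1 hw'.1
    dsimp only at h
    rw [hw.2, h] at h1
    rw [hw'.2] at h2
    exact Subtype.ext (h1.trans h2.symm)
  · refine ⟨⟨v.1 ++ [a], ha⟩, ⟨?_, ?_⟩, by simp⟩
    · simp [root]
    · simp [parent]

theorem setOf_child_eq (T : PlaneTree) (w : List ℕ) :
    {a | w ++ [a] ∈ T.words} = Set.Iio (T.offspring w) :=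
  eq_Iio_ncard ((T.words.finite_toSet.preimage
    (f := fun a : ℕ => w ++ [a]) (fun a _ b _ h => by simpa using h))) (T.sibling_mem w)

theorem ncard_children (T : PlaneTree) (v : T.Vertex) :
    (children T.parent T.root v).ncard = T.offspring v.1 := by
  rw [offspring, ← (T.bijOn_getLastD v).image_eq,
    (T.bijOn_getLastD v).injOn.ncard_image]

theorem isOrdering (T : PlaneTree) :
    IsOrdering T.parent T.root (fun w => w.1.getLastD 0) := by
  -- The default value `0` of `getLastD` on the empty word is what `map_root` requires.
  refine ⟨rfl, fun v => ?_⟩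
  rw [ncard_children, ← setOf_child_eq]
  exact T.bijOn_getLastD v

end PlaneTree

theorem children_transport {V W : Type} (p : V → V) (r v : V) (e : V ≃ W) :
    children (fun w => e (p (e.symm w))) (e r) (e v) = e '' children p r v := by
  ext w
  simp [children, Equiv.symm_apply_eq]

theorem IsOrdering.transport {V W : Type} {p : V → V} {r : V} {q : V → ℕ}
    (h : IsOrdering p r q) (e : V ≃ W) :
    IsOrdering (fun w => e (p (e.symm w))) (e r) (fun w => q (e.symm w)) := by
  refine ⟨by simp [h.map_root], fun w => ?_⟩
  obtain ⟨v, rfl⟩ := e.surjective w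
  rw [children_transport, Set.ncard_image_of_injective _ e.injective]
  refine (h.bijOn v).comp (t := children p r v) ⟨?_, e.symm.injective.injOn, ?_⟩
  · rintro _ ⟨w, hw, rfl⟩
    simpa
  · intro w hw
    exact ⟨e w, ⟨w, hw, rfl⟩, by simp⟩

theorem orderedTree_ext {V : Type} {y y' : Σ t : {t : (V → V) × V // IsRootedTree t.1 t.2},
    {q : V → ℕ // IsOrdering t.1.1 t.1.2 q}} (h : y.1.1 = y'.1.1) (h' : y.2.1 = y'.2.1) :
    y = y' := by
  obtain ⟨⟨t, ht⟩, q, hq⟩ := y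
  obtain ⟨⟨t', ht'⟩, q', hq'⟩ := y'
  dsimp only at h h'
  subst h h'
  rfl

/-- Labelled plane trees correspond to rooted labelled trees with an ordering of the children of
every vertex. -/
noncomputable def labelEquiv (n : ℕ) :
    (Σ T : {T : PlaneTree // T.size = n}, (T.1.Vertex ≃ Fin n)) ≃
      Σ t : {t : (Fin n → Fin n) × Fin n // IsRootedTree t.1 t.2},
        {q : Fin n → ℕ // IsOrdering t.1.1 t.1.2 q} := by
  classical
  refine Equiv.ofBijective (fun x => ⟨⟨(_, _), x.1.1.isRootedTree.transport x.2⟩,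
    ⟨_, x.1.1.isOrdering.transport x.2⟩⟩) ⟨?_, ?_⟩
  · rintro ⟨⟨T, hT⟩, e⟩ ⟨⟨T', hT'⟩, e'⟩ h
    have hp := congrArg (fun y => y.1.1.1) h
    have hr := congrArg (fun y => y.1.1.2) h
    have hq := congrArg (fun y => y.2.1) h
    dsimp only at hp hr hq
    -- Moving away from the root, the word of a vertex is the word of its parent followed by its
    -- order number; so the labelled data determine all words.
    have key : ∀ v, (e.symm v).1 = (e'.symm v).1 := by
      refine (T.isRootedTree.transport e).induction ?_ fun v hv ih => ?_
      · rw [hr, Equiv.symm_apply_apply, ← hr, Equiv.symm_apply_apply]; rfl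
      · have h1 := (T.ne_root_iff (e.symm v)).1 (by rwa [ne_eq, Equiv.symm_apply_eq])
        have h2 := (T'.ne_root_iff (e'.symm v)).1 (by rw [ne_eq, Equiv.symm_apply_eq, ← hr]; exact hv)
        have h3 := congrFun hp v
        have h4 := congrFun hq v
        rw [h1, h2, h4]
        congr 1
        rw [h3] at ih
        rw [Equiv.symm_apply_apply, ← h3, Equiv.symm_apply_apply] at ih
        exact ih
    have hTT : T = T' := by
      apply PlaneTree.words_injective
      ext w
      refine ⟨fun hw => ?_, fun hw => ?_⟩
      · have := key (e ⟨w, hw⟩)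
        rw [Equiv.symm_apply_apply] at this
        rw [show w = _ from this]
        exact Subtype.property _
      · have := key (e' ⟨w, hw⟩)
        rw [Equiv.symm_apply_apply] at this
        rw [show w = _ from this.symm]
        exact Subtype.property _
    subst hTT
    congr 1
    rw [← Equiv.symm_bijective.injective.eq_iff]
    ext1 v
    exact Subtype.ext (key v)
  · rintro ⟨⟨⟨p, r⟩, hT⟩, q, hq⟩
    -- Conversely, the words are rebuilt by appending order numbers along the path from the root.
    obtain ⟨addr, h0, h1⟩ := hT.exists_rec [] fun v (l : List ℕ) => l ++ [q v]
    have hnil : ∀ v, addr v = [] → v = r := fun v hv => by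
      by_contra hne
      simp [h1 v hne] at hv
    have hcons : ∀ v w a, addr v = w ++ [a] → v ≠ r ∧ addr (p v) = w ∧ q v = a := by
      intro v w a h
      have hv : v ≠ r := by
        rintro rfl
        simp [h0] at h
      rw [h1 v hv] at h
      exact ⟨hv, by simpa using List.append_inj' h rfl⟩
    have hinj : Function.Injective addr := by
      have : ∀ v, ∀ v', addr v = addr v' → v = v' := by
        refine hT.induction (fun v' h => (hnil v' (h ▸ h0)).symm) fun v hv ih v' h => ?_
        rw [h1 v hv] at h
        obtain ⟨hv', h2, h3⟩ := hcons v' _ _ h.symm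
        exact (hq.bijOn (p v)).injOn ⟨hv, rfl⟩ ⟨hv', (ih _ h2.symm).symm⟩ h3.symm
      exact fun v v' => this v v'
    let T : PlaneTree :=
      { words := Finset.univ.image addr
        root_mem := by simpa using ⟨r, h0⟩
        parent_mem := fun w a h => by
          obtain ⟨v, hv⟩ : ∃ v, addr v = w ++ [a] := by simpa using h
          simpa using ⟨p v, (hcons v w a hv).2.1⟩
        sibling_mem := fun w a h => by
          obtain ⟨v, hv⟩ : ∃ v, addr v = w ++ [a + 1] := by simpa using h
          obtain ⟨h2, h3, h4⟩ := hcons v w _ hv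
          have h5 : q v < (children p r (p v)).ncard := (hq.bijOn (p v)).mapsTo ⟨h2, rfl⟩
          -- The order numbers of siblings fill an initial segment, so a sibling numbered `a`
          -- exists.
          obtain ⟨v', hv', h6⟩ := (hq.bijOn (p v)).surjOn (show a ∈ Set.Iio _ by
            simp only [Set.mem_Iio]; omega)
          simpa using ⟨v', by rw [h1 v' hv'.1, hv'.2, h3, h6]⟩ }
    have hmem : ∀ v, addr v ∈ T.words := fun v => Finset.mem_image_of_mem _ (Finset.mem_univ v)
    let e : Fin n ≃ T.Vertex := Equiv.ofBijective (fun v => ⟨addr v, hmem v⟩)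
      ⟨fun v v' h => hinj (congrArg Subtype.val h), fun ⟨w, hw⟩ => by
        obtain ⟨v, -, hv⟩ := Finset.mem_image.1 hw
        exact ⟨v, Subtype.ext hv⟩⟩
    have hsize : T.size = n := by
      simp only [PlaneTree.size, T]
      rw [Finset.card_image_of_injective _ hinj]
      simp
    have hroot : T.root = e r := Subtype.ext h0.symm
    have hpar : ∀ v, T.parent (e v) = e (p v) := fun v => by
      apply Subtype.ext
      change (addr v).dropLast = addr (p v)
      by_cases hv : v = r
      · rw [hv, show p r = r from hT.map_root, show addr r = [] from h0]; rfl
      · rw [h1 v hv, List.dropLast_concat]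
    have hlast : ∀ v, (e v).1.getLastD 0 = q v := fun v => by
      change (addr v).getLastD 0 = q v
      by_cases hv : v = r
      · rw [hv, h0, hq.map_root]; rfl
      · rw [h1 v hv]; simp
    refine ⟨⟨⟨T, hsize⟩, e.symm⟩, ?_⟩
    have hP : (fun w => e.symm (T.parent (e.symm.symm w))) = p := by
      funext v
      rw [Equiv.symm_symm, hpar, Equiv.symm_apply_apply]
    have hR : e.symm T.root = r := by rw [hroot, Equiv.symm_apply_apply]
    have hQ : (fun w => (e.symm.symm w).1.getLastD 0) = q := by
      funext v
      rw [Equiv.symm_symm, hlast]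
    exact orderedTree_ext (Prod.ext hP hR) hQ

/-! ### Weighted number of copies in plane trees of given size -/

instance finite_ordering {V : Type} [Finite V] (p : V → V) (r : V) :
    Finite {q : V → ℕ // IsOrdering p r q} := by
  have := Fintype.ofFinite V
  apply Nat.finite_of_card_ne_zero
  rw [card_ordering]
  exact Finset.prod_ne_zero_iff.2 fun v _ => Nat.factorial_ne_zero _

instance finite_labelled (n : ℕ) :
    Finite (Σ T : {T : PlaneTree // T.size = n}, (T.1.Vertex ≃ Fin n)) :=
  Finite.of_equiv _ (labelEquiv n).symm

theorem PlaneTree.card_vertex (T : PlaneTree) : Fintype.card T.Vertex = T.size :=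
  Fintype.card_coe T.words

instance finite_size (n : ℕ) : Finite {T : PlaneTree // T.size = n} := by
  refine Finite.of_surjective
    (Sigma.fst : (Σ T : {T : PlaneTree // T.size = n}, (T.1.Vertex ≃ Fin n)) → _) fun T => ?_
  exact ⟨⟨T, Fintype.equivFinOfCardEq (T.1.card_vertex.trans T.2)⟩, rfl⟩

theorem isTreeEmb_transport {B V W : Type} {pB : B → B} {b₀ : B} {p : V → V} {r : V} (e : V ≃ W)
    (h : B ↪ V) :
    IsTreeEmb pB b₀ (fun w => e (p (e.symm w))) (e r) (h.trans e.toEmbedding) ↔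
      IsTreeEmb pB b₀ p r h := by
  simp [IsTreeEmb]

theorem card_isTreeEmb_transport {B V W : Type} (pB : B → B) (b₀ : B) (p : V → V) (r : V)
    (e : V ≃ W) :
    Nat.card {h : B ↪ W // IsTreeEmb pB b₀ (fun w => e (p (e.symm w))) (e r) h} =
      Nat.card {h : B ↪ V // IsTreeEmb pB b₀ p r h} := by
  refine (Nat.card_congr (Equiv.subtypeEquiv ((Equiv.refl B).embeddingCongr e) fun h => ?_)).symm
  rw [← isTreeEmb_transport e]
  rfl

theorem PlaneTree.weight_eq (T : PlaneTree) {n : ℕ} (e : T.Vertex ≃ Fin n) :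
    T.weight = Real.exp (-1) ^ n * ∏ v : Fin n,
      (((children (fun w => e (T.parent (e.symm w))) (e T.root) v).ncard.factorial : ℕ) : ℝ)⁻¹ := by
  have h : ∀ v : T.Vertex,
      (children (fun w => e (T.parent (e.symm w))) (e T.root) (e v)).ncard = T.offspring v.1 :=
    fun v => by
      rw [children_transport, Set.ncard_image_of_injective _ e.injective, T.ncard_children]
  rw [weight, ← Equiv.prod_comp e, ← Finset.prod_coe_sort]
  simp_rw [h, div_eq_mul_inv]
  rw [Finset.prod_mul_distrib, Finset.prod_const, Finset.card_univ, Fintype.card_congr e,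
    Fintype.card_fin]

/-- Each plane tree has `n!` labellings. Summing over labelled plane trees and then over the
orderings of a fixed labelled tree gives a factor `∏ ξ!`, cancelling the `1 / ξ!`; the number of
copies does not depend on labels or orderings. -/
theorem factorial_mul_sum_weight {B : Type} [Finite B] (pB : B → B) (b₀ : B) (n : ℕ)
    [Fintype {T : PlaneTree // T.size = n}] :
    (n.factorial : ℝ) * ∑ T : {T : PlaneTree // T.size = n},
      T.1.weight * Nat.card {h : B ↪ T.1.Vertex // IsTreeEmb pB b₀ T.1.parent T.1.root h} =
    Real.exp (-1) ^ n * Nat.card (Σ h : B ↪ Fin n,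
      {t : (Fin n → Fin n) × Fin n // IsRootedTree t.1 t.2 ∧ IsTreeEmb pB b₀ t.1 t.2 h}) := by
  classical
  have := Fintype.ofFinite B
  have := fun t : {t : (Fin n → Fin n) × Fin n // IsRootedTree t.1 t.2} =>
    Fintype.ofFinite {q : Fin n → ℕ // IsOrdering t.1.1 t.1.2 q}
  have := fun t : {t : (Fin n → Fin n) × Fin n // IsRootedTree t.1 t.2} =>
    Fintype.ofFinite {h : B ↪ Fin n // IsTreeEmb pB b₀ t.1.1 t.1.2 h}
  have h1 : ∀ T : {T : PlaneTree // T.size = n}, Fintype.card (T.1.Vertex ≃ Fin n) =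
      n.factorial := fun T => by
    rw [Fintype.card_equiv (Fintype.equivFinOfCardEq (T.1.card_vertex.trans T.2)),
      T.1.card_vertex, T.2]
  let c : {t : (Fin n → Fin n) × Fin n // IsRootedTree t.1 t.2} → ℝ := fun t =>
    Nat.card {h : B ↪ Fin n // IsTreeEmb pB b₀ t.1.1 t.1.2 h}
  let w : {t : (Fin n → Fin n) × Fin n // IsRootedTree t.1 t.2} → ℝ := fun t =>
    ∏ v : Fin n, (((children t.1.1 t.1.2 v).ncard.factorial : ℕ) : ℝ)⁻¹
  calc _ = ∑ x : Σ T : {T : PlaneTree // T.size = n}, (T.1.Vertex ≃ Fin n),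
        x.1.1.weight * Nat.card {h : B ↪ x.1.1.Vertex //
          IsTreeEmb pB b₀ x.1.1.parent x.1.1.root h} := by
        rw [Fintype.sum_sigma, Finset.mul_sum]
        refine Finset.sum_congr rfl fun T _ => ?_
        dsimp only
        rw [Finset.sum_const, Finset.card_univ, h1, nsmul_eq_mul]
    _ = ∑ y : Σ t : {t : (Fin n → Fin n) × Fin n // IsRootedTree t.1 t.2},
        {q : Fin n → ℕ // IsOrdering t.1.1 t.1.2 q}, Real.exp (-1) ^ n * w y.1 * c y.1 := by
        refine Fintype.sum_equiv (labelEquiv n) _ _ fun x => ?_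
        rw [x.1.1.weight_eq x.2, ← card_isTreeEmb_transport _ _ _ _ x.2]
        rfl
    _ = ∑ t : {t : (Fin n → Fin n) × Fin n // IsRootedTree t.1 t.2},
        Real.exp (-1) ^ n * c t := by
        rw [Fintype.sum_sigma]
        refine Finset.sum_congr rfl fun t _ => ?_
        dsimp only
        rw [Finset.sum_const, Finset.card_univ, ← Nat.card_eq_fintype_card, card_ordering,
          nsmul_eq_mul, Nat.cast_prod]
        have : (∏ v : Fin n, ((children t.1.1 t.1.2 v).ncard.factorial : ℝ)) * w t = 1 := by
          rw [← Finset.prod_mul_distrib]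
          exact Finset.prod_eq_one fun v _ =>
            mul_inv_cancel₀ (Nat.cast_ne_zero.2 (Nat.factorial_ne_zero _))
        linear_combination (Real.exp (-1) ^ n * c t) * this
    _ = _ := by
        rw [← Finset.mul_sum]
        congr 1
        have e : (Σ h : B ↪ Fin n, {t : (Fin n → Fin n) × Fin n // IsRootedTree t.1 t.2 ∧
            IsTreeEmb pB b₀ t.1 t.2 h}) ≃
            Σ t : {t : (Fin n → Fin n) × Fin n // IsRootedTree t.1 t.2},
              {h : B ↪ Fin n // IsTreeEmb pB b₀ t.1.1 t.1.2 h} :=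
          { toFun := fun x => ⟨⟨x.2.1, x.2.2.1⟩, ⟨x.1, x.2.2.2⟩⟩
            invFun := fun y => ⟨y.2.1, ⟨y.1.1, y.1.2, y.2.2⟩⟩
            left_inv := fun _ => rfl
            right_inv := fun _ => rfl }
        rw [Nat.card_congr e, Nat.card_sigma, Nat.cast_sum]

/-- The expected number of copies of a rooted tree with `b` vertices at the root of a critical
Poisson branching process, on the event that the total progeny is `n`. -/
theorem sum_weight_mul_card_emb {B : Type} [Finite B] {pB : B → B} {b₀ : B}
    (hB : IsRootedTree pB b₀) (n : ℕ) [Fintype {T : PlaneTree // T.size = n}] :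
    (n.factorial * n : ℝ) * ∑ T : {T : PlaneTree // T.size = n},
      T.1.weight * Nat.card {h : B ↪ T.1.Vertex // IsTreeEmb pB b₀ T.1.parent T.1.root h} =
    Real.exp (-1) ^ n * (n.descFactorial (Nat.card B) *
      (Nat.card B * (n : ℝ) ^ (n - Nat.card B))) := by
  have h := card_tree_embeddings (V := Fin n) hB
  rw [Nat.card_fin] at h
  rw [mul_right_comm, factorial_mul_sum_weight, mul_assoc]
  congr 1
  exact_mod_cast h

/-! ### Trees given by edges, and their subdivision -/

/-- A finite rooted tree given by its edges, oriented away from the root, with some marked vertices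
`leaf l` below every vertex. -/
structure IsEdgeTree {W E L : Type} (root : W) (leaf : L → W) (src tgt : E → W) : Prop where
  tgt_injective : Function.Injective tgt
  tgt_ne_root : ∀ j, tgt j ≠ root
  induction : ∀ P : W → Prop, P root → (∀ j, P (src j) → P (tgt j)) → ∀ v, P v
  leaf_induction : ∀ P : W → Prop, (∀ l, P (leaf l)) → (∀ j, P (tgt j) → P (src j)) → ∀ v, P v

namespace IsEdgeTree

variable {W E L : Type} {root : W} {leaf : L → W} {src tgt : E → W}

/-- Since `tgt` is injective and misses the root, each edge is determined by its far end; this gives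
a parent map, and recursion along it applies. -/
theorem exists_rec (h : IsEdgeTree root leaf src tgt) {X : Type} (x₀ : X) (G : E → X → X) :
    ∃ F : W → X, F root = x₀ ∧ ∀ j, F (tgt j) = G j (F (src j)) := by
  classical
  let p : W → W := fun v => if hv : ∃ j, tgt j = v then src hv.choose else v
  have hp : ∀ j, p (tgt j) = src j := fun j => by
    have hv : ∃ j', tgt j' = tgt j := ⟨j, rfl⟩
    simp only [p, hv, dite_true]
    rw [h.tgt_injective hv.choose_spec]
  have hpr : p root = root := by
    have hv : ¬ ∃ j, tgt j = root := fun ⟨j, hj⟩ => h.tgt_ne_root j hj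
    simp only [p, hv, dite_false]
  have hT : IsRootedTree p root := by
    refine ⟨hpr, fun S ⟨v, hv⟩ hS => ?_⟩
    refine h.induction (fun v => v ∈ S → root ∈ S) id (fun j ih hj => ih ?_) v hv
    exact hp j ▸ hS _ hj
  obtain ⟨F, h0, h1⟩ := hT.exists_rec x₀
    (fun v x => if hv : ∃ j, tgt j = v then G hv.choose x else x)
  refine ⟨F, h0, fun j => ?_⟩
  have hv : ∃ j', tgt j' = tgt j := ⟨j, rfl⟩
  rw [h1 _ (h.tgt_ne_root j), hp]
  simp only [hv, dite_true]
  rw [h.tgt_injective hv.choose_spec]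

/-- The vertices of the tree in which edge `j` is replaced by a path of length `s j`: the root, and
the endpoint farther from the root of every bond. -/
abbrev Bond (s : E → ℕ) : Type := Option (Σ j, Fin (s j))

/-- An edge with `s j = 0` is contracted, so its two ends share an image; otherwise the far end is
the last bond, with index `s j - 1`. -/
theorem exists_top (h : IsEdgeTree root leaf src tgt) (s : E → ℕ) :
    ∃ F : W → Bond s, F root = none ∧ ∀ j, F (tgt j) =
      if hs : s j = 0 then F (src j) else some ⟨j, ⟨s j - 1, by omega⟩⟩ :=
  h.exists_rec (none : Bond s)
    fun j x => if hs : s j = 0 then x else some ⟨j, ⟨s j - 1, by omega⟩⟩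

/-- The vertex of the subdivided tree that corresponds to the vertex `v`. -/
noncomputable def top (h : IsEdgeTree root leaf src tgt) (s : E → ℕ) : W → Bond s :=
  (h.exists_top s).choose

theorem top_root (h : IsEdgeTree root leaf src tgt) (s : E → ℕ) : h.top s root = none :=
  (h.exists_top s).choose_spec.1

theorem top_tgt (h : IsEdgeTree root leaf src tgt) (s : E → ℕ) (j : E) :
    h.top s (tgt j) = if hs : s j = 0 then h.top s (src j) else some ⟨j, ⟨s j - 1, by omega⟩⟩ :=
  (h.exists_top s).choose_spec.2 j

/-- The vertices on the path that replaces edge `j`. -/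
noncomputable def node (h : IsEdgeTree root leaf src tgt) (s : E → ℕ) (j : E) :
    (r : ℕ) → r ≤ s j → Bond s
  | 0, _ => h.top s (src j)
  | r + 1, hr => some ⟨j, ⟨r, hr⟩⟩

theorem node_last (h : IsEdgeTree root leaf src tgt) (s : E → ℕ) (j : E) :
    h.node s j (s j) le_rfl = h.top s (tgt j) := by
  rw [top_tgt]
  split_ifs with hs
  · have : ∀ r (hr : r ≤ s j), r = 0 → h.node s j r hr = h.top s (src j) := by
      rintro r hr rfl
      rfl
    exact this _ _ hs
  · have : ∀ r (hr : r ≤ s j) (h0 : r ≠ 0), h.node s j r hr =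
        some ⟨j, ⟨r - 1, by omega⟩⟩ := by
      rintro (_ | r) hr h0
      · exact absurd rfl h0
      · rfl
    exact this _ _ hs

/-- The parent map of the subdivided tree. -/
noncomputable def bondParent (h : IsEdgeTree root leaf src tgt) (s : E → ℕ) : Bond s → Bond s
  | none => none
  | some x => h.node s x.1 x.2 x.2.2.le

theorem bondParent_node (h : IsEdgeTree root leaf src tgt) (s : E → ℕ) (j : E) (r : ℕ)
    (hr : r + 1 ≤ s j) :
    h.bondParent s (h.node s j (r + 1) hr) = h.node s j r (Nat.le_of_succ_le hr) := rfl

theorem isRootedTree_bondParent (h : IsEdgeTree root leaf src tgt) (s : E → ℕ) :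
    IsRootedTree (h.bondParent s) none := by
  refine ⟨rfl, fun S ⟨x, hx⟩ hS => ?_⟩
  have desc : ∀ j r (hr : r ≤ s j), h.node s j r hr ∈ S → h.top s (src j) ∈ S := by
    intro j r
    induction r with
    | zero => exact fun _ h => h
    | succ r ih => exact fun hr hmem => ih _ (hS _ hmem)
  have htop : ∀ v, h.top s v ∈ S → none ∈ S := by
    refine h.induction _ (fun hv => h.top_root s ▸ hv) fun j ih hj => ih ?_
    exact desc j (s j) le_rfl (by rwa [node_last])
  rcases x with _ | ⟨j, r, hr⟩
  · exact hx
  · exact htop (src j) (desc j (r + 1) hr hx)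

/-- Used to write the displacement along an edge of the shape as the sum of the steps on its bonds.
-/
theorem sum_telescope (h : IsEdgeTree root leaf src tgt) (s : E → ℕ) {G : Type} [AddCommGroup G]
    (F : Bond s → G) (j : E) :
    ∑ r : Fin (s j), (F (some ⟨j, r⟩) - F (h.bondParent s (some ⟨j, r⟩))) =
      F (h.top s (tgt j)) - F (h.top s (src j)) := by
  have key : ∀ r (hr : r ≤ s j), ∑ i : Fin r, (F (some ⟨j, Fin.castLE hr i⟩) -
      F (h.bondParent s (some ⟨j, Fin.castLE hr i⟩))) =
        F (h.node s j r hr) - F (h.top s (src j)) := by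
    intro r
    induction r with
    | zero => intro hr; simp [node]
    | succ r ih =>
      intro hr
      rw [Fin.sum_univ_castSucc]
      have := ih (Nat.le_of_succ_le hr)
      have e : ∀ i : Fin r, Fin.castLE hr i.castSucc = Fin.castLE (Nat.le_of_succ_le hr) i :=
        fun i => rfl
      simp_rw [e]
      rw [this]
      have e1 : (some ⟨j, Fin.castLE hr (Fin.last r)⟩ : Bond s) = h.node s j (r + 1) hr := rfl
      rw [e1, bondParent_node]
      abel
  have := key (s j) le_rfl
  rw [node_last] at this
  exact this

theorem card_bond [Fintype E] (s : E → ℕ) : Nat.card (Bond s) = ∑ j, s j + 1 := by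
  rw [Nat.card_eq_fintype_card, Fintype.card_option, Fintype.card_sigma]
  simp

end IsEdgeTree

/-! ### Skeletons in a plane tree and embeddings of the subdivided tree -/

theorem PlaneTree.mem_of_prefix (T : PlaneTree) {v w : List ℕ} (h : v <+: w) (hw : w ∈ T.words) :
    v ∈ T.words := by
  obtain ⟨u, rfl⟩ := h
  induction u using List.reverseRecOn with
  | nil => simpa using hw
  | append_singleton u a ih => exact ih (T.parent_mem _ a (by simpa using hw))

theorem eq_of_prefix_of_length {v v' w : List ℕ} (h : v <+: w) (h' : v' <+: w)
    (hl : v.length = v'.length) : v = v' :=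
  (List.prefix_of_prefix_length_le h h' hl.le).eq_of_length hl

/-- `f` exhibits the subtree spanned by the vertices `f (leaf l)` as the tree `(root, src, tgt)`
with edge `j` replaced by a path of length `s j`. -/
structure IsSkeleton {W E L : Type} (root : W) (leaf : L → W) (src tgt : E → W) (s : E → ℕ)
    (T : PlaneTree) (f : W → T.Vertex) : Prop where
  map_root : f root = T.root
  isPrefix : ∀ j, (f (src j)).1 <+: (f (tgt j)).1
  length : ∀ j, (f (tgt j)).1.length = (f (src j)).1.length + s j
  existsUnique : ∀ w : T.Vertex, (∃ l, w.1 <+: (f (leaf l)).1) → w ≠ T.root →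
    ∃! j, w ∈ T.pathBonds (f (src j)) (f (tgt j))

namespace IsSkeleton

variable {W E L : Type} {root : W} {leaf : L → W} {src tgt : E → W} {s : E → ℕ} {T : PlaneTree}
  {f f' : W → T.Vertex}

/-- The lengths `s` fix the generation of every vertex, and an ancestor is determined by its
generation and a descendant; so the images of the leaves determine the rest. Hence a sum over marked
vertices can become a sum over skeletons. -/
theorem ext_leaf (h : IsEdgeTree root leaf src tgt) (hf : IsSkeleton root leaf src tgt s T f)
    (hf' : IsSkeleton root leaf src tgt s T f') (hl : ∀ l, f (leaf l) = f' (leaf l)) : f = f' := by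
  have hlen : ∀ v, (f v).1.length = (f' v).1.length := by
    refine h.induction _ (by rw [hf.map_root, hf'.map_root]) fun j ih => ?_
    rw [hf.length, hf'.length, ih]
  funext v
  refine h.leaf_induction (fun v => f v = f' v) hl (fun j ih => ?_) v
  exact Subtype.ext (eq_of_prefix_of_length (hf.isPrefix j) (ih ▸ hf'.isPrefix j) (hlen _))

theorem exists_prefix_leaf (h : IsEdgeTree root leaf src tgt)
    (hf : IsSkeleton root leaf src tgt s T f) : ∀ v, ∃ l, (f v).1 <+: (f (leaf l)).1 :=
  h.leaf_induction _ (fun l => ⟨l, List.prefix_rfl⟩)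
    fun j ⟨l, hl⟩ => ⟨l, (hf.isPrefix j).trans hl⟩

end IsSkeleton

section embeddings

variable {W E L : Type} {root : W} {leaf : L → W} {src tgt : E → W} {s : E → ℕ} {T : PlaneTree}

theorem IsTreeEmb.append {B : Type} {pB : B → B} {b₀ : B} {g : B ↪ T.Vertex}
    (hg : IsTreeEmb pB b₀ T.parent T.root g) {β : B} (hβ : β ≠ b₀) :
    ∃ a, (g β).1 = (g (pB β)).1 ++ [a] := by
  have : g β ≠ T.root := by
    rw [← hg.1]
    exact fun h => hβ (g.injective h)
  rw [T.ne_root_iff, hg.2] at this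
  exact ⟨_, this⟩

variable {g : IsEdgeTree.Bond s ↪ T.Vertex}

theorem length_node (h : IsEdgeTree root leaf src tgt)
    (hg : IsTreeEmb (h.bondParent s) none T.parent T.root g) (j : E) (r : ℕ) (hr : r ≤ s j) :
    (g (h.node s j r hr)).1.length = (g (h.top s (src j))).1.length + r := by
  induction r with
  | zero => rfl
  | succ r ih =>
    obtain ⟨a, ha⟩ := hg.append (β := h.node s j (r + 1) hr) (by simp [IsEdgeTree.node])
    rw [ha, h.bondParent_node, List.length_append, ih]
    rfl

theorem prefix_node (h : IsEdgeTree root leaf src tgt)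
    (hg : IsTreeEmb (h.bondParent s) none T.parent T.root g) (j : E) (r r' : ℕ) (hr : r ≤ s j)
    (hr' : r' ≤ r) :
    (g (h.node s j r' (hr'.trans hr))).1 <+: (g (h.node s j r hr)).1 := by
  induction r with
  | zero =>
    obtain rfl : r' = 0 := by omega
    exact List.prefix_rfl
  | succ r ih =>
    rcases Nat.lt_or_ge r r' with hlt | hle
    · obtain rfl : r' = r + 1 := by omega
      exact List.prefix_rfl
    · obtain ⟨a, ha⟩ := hg.append (β := h.node s j (r + 1) hr) (by simp [IsEdgeTree.node])
      rw [ha, h.bondParent_node]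
      exact (ih _ hle).trans (List.prefix_append _ _)

theorem mem_pathBonds_iff (h : IsEdgeTree root leaf src tgt)
    (hg : IsTreeEmb (h.bondParent s) none T.parent T.root g) (j : E) (w : T.Vertex) :
    w ∈ T.pathBonds (g (h.top s (src j))) (g (h.top s (tgt j))) ↔ ∃ r, w = g (some ⟨j, r⟩) := by
  constructor
  · rintro ⟨h1, h2, h3⟩
    rw [← h.node_last] at h3
    have h4 := h3.length_le
    have h5 := h1.length_le
    rw [length_node h hg] at h4
    have h6 : (g (h.top s (src j))).1.length ≠ w.1.length := fun hl =>
      h2 (Subtype.ext (h1.eq_of_length hl)).symm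
    obtain ⟨r, hr⟩ := Nat.exists_eq_add_of_lt (lt_of_le_of_ne h5 h6)
    have hrs : r + 1 ≤ s j := by omega
    refine ⟨⟨r, hrs⟩, Subtype.ext (eq_of_prefix_of_length h3
      (prefix_node h hg j (s j) (r + 1) le_rfl hrs) ?_)⟩
    have := length_node h hg j (r + 1) hrs
    exact hr.trans this.symm
  · rintro ⟨⟨r, hr⟩, rfl⟩
    refine ⟨prefix_node h hg j (r + 1) 0 hr (Nat.zero_le _), fun heq => ?_, ?_⟩
    · have := congrArg (fun w => w.1.length) heq
      have h1 := length_node h hg j (r + 1) hr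
      have h2 : g (h.node s j (r + 1) hr) = g (some ⟨j, ⟨r, hr⟩⟩) := rfl
      rw [h2] at h1
      rw [this] at h1
      omega
    · rw [← h.node_last]
      exact prefix_node h hg j (s j) (r + 1) le_rfl hr

/-- A nonroot ancestor of a marked vertex lies on some edge path by induction from the root; the
edge is unique because `g` is injective and a bond names its edge. -/
theorem isSkeleton_comp_top (h : IsEdgeTree root leaf src tgt)
    (hg : IsTreeEmb (h.bondParent s) none T.parent T.root g) :
    IsSkeleton root leaf src tgt s T (fun v => g (h.top s v)) := by
  have hpre : ∀ j, (g (h.top s (src j))).1 <+: (g (h.top s (tgt j))).1 := fun j => by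
    rw [← h.node_last]
    exact prefix_node h hg j (s j) 0 le_rfl (Nat.zero_le _)
  refine ⟨by rw [h.top_root, hg.1], hpre, fun j => ?_, ?_⟩
  · rw [← h.node_last, length_node h hg]
  · rintro w ⟨l, hl⟩ hw
    have ex : ∀ v, w.1 <+: (g (h.top s v)).1 →
        ∃ j, w ∈ T.pathBonds (g (h.top s (src j))) (g (h.top s (tgt j))) := by
      refine h.induction _ (fun hv => ?_) fun j ih hj => ?_
      · rw [h.top_root, hg.1] at hv
        exact absurd (Subtype.ext (List.prefix_nil.1 hv)) hw
      · by_cases heq : w = g (h.top s (src j))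
        · exact ih (heq ▸ List.prefix_rfl)
        · rcases List.prefix_or_prefix_of_prefix hj (hpre j) with h1 | h1
          · exact ih h1
          · exact ⟨j, h1, heq, hj⟩
    obtain ⟨j, hj⟩ := ex _ hl
    refine ⟨j, hj, fun j' hj' => ?_⟩
    obtain ⟨r, hr⟩ := (mem_pathBonds_iff h hg j w).1 hj
    obtain ⟨r', hr'⟩ := (mem_pathBonds_iff h hg j' w).1 hj'
    have := g.injective (hr'.symm.trans hr)
    simp only [Option.some.injEq, Sigma.mk.injEq] at this
    exact this.1

/-- The embedding of the subdivided tree given by a skeleton. -/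
noncomputable def bondMap (src tgt : E → W) (s : E → ℕ) (f : W → T.Vertex) :
    IsEdgeTree.Bond s → T.Vertex
  | none => T.root
  | some x => ⟨(f (tgt x.1)).1.take ((f (src x.1)).1.length + (x.2 + 1)),
      T.mem_of_prefix (List.take_prefix _ _) (f (tgt x.1)).2⟩

variable {f : W → T.Vertex}

theorem IsSkeleton.bondMap_top (h : IsEdgeTree root leaf src tgt)
    (hf : IsSkeleton root leaf src tgt s T f) : ∀ v, bondMap src tgt s f (h.top s v) = f v := by
  refine h.induction _ (by rw [h.top_root, hf.map_root]; rfl) fun j ih => ?_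
  rw [h.top_tgt]
  split_ifs with hs
  · rw [ih]
    exact Subtype.ext ((hf.isPrefix j).eq_of_length (by rw [hf.length, hs]; rfl))
  · apply Subtype.ext
    simp only [bondMap]
    apply List.take_of_length_le
    rw [hf.length]
    omega

theorem IsSkeleton.length_bondMap (hf : IsSkeleton root leaf src tgt s T f) (x : Σ j, Fin (s j)) :
    (bondMap src tgt s f (some x)).1.length = (f (src x.1)).1.length + (x.2 + 1) := by
  have := x.2.2
  simp only [bondMap, List.length_take, hf.length]
  omega

theorem IsSkeleton.bondMap_node (h : IsEdgeTree root leaf src tgt)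
    (hf : IsSkeleton root leaf src tgt s T f) (j : E) (r : ℕ) (hr : r ≤ s j) :
    (bondMap src tgt s f (h.node s j r hr)).1 =
      (f (tgt j)).1.take ((f (src j)).1.length + r) := by
  cases r with
  | zero =>
    rw [IsEdgeTree.node, hf.bondMap_top h]
    exact List.prefix_iff_eq_take.1 (hf.isPrefix j)
  | succ r => rfl

/-- The image of a bond lies on the path of its own edge, so `existsUnique` recovers the edge and
the word length recovers the position. `existsUnique` applies because every image is an ancestor of
a marked vertex. -/
theorem IsSkeleton.bondMap_injective (h : IsEdgeTree root leaf src tgt)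
    (hf : IsSkeleton root leaf src tgt s T f) : Function.Injective (bondMap src tgt s f) := by
  have hne : ∀ x, bondMap src tgt s f (some x) ≠ T.root := fun x hx => by
    have := hf.length_bondMap x
    rw [hx] at this
    simp [PlaneTree.root] at this
  have hmem : ∀ x : Σ j, Fin (s j), bondMap src tgt s f (some x) ∈
      T.pathBonds (f (src x.1)) (f (tgt x.1)) := fun x => by
    have hlen := hf.length_bondMap x
    have hpre : (bondMap src tgt s f (some x)).1 <+: (f (tgt x.1)).1 := List.take_prefix _ _
    refine ⟨List.prefix_of_prefix_length_le (hf.isPrefix _) hpre (by omega), fun heq => ?_, hpre⟩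
    rw [heq] at hlen
    omega
  rintro (_ | x) (_ | x') hx
  · rfl
  · exact absurd hx.symm (hne x')
  · exact absurd hx (hne x)
  · obtain ⟨l, hl⟩ := hf.exists_prefix_leaf h (tgt x.1)
    have hj : x.1 = x'.1 := (hf.existsUnique _ ⟨l, (hmem x).2.2.trans hl⟩ (hne x)).unique
      (hmem x) (hx ▸ hmem x')
    have h1 := hf.length_bondMap x
    have h2 := hf.length_bondMap x'
    obtain ⟨j, r⟩ := x
    obtain ⟨j', r'⟩ := x'
    dsimp only at hj
    subst hj
    rw [hx, h2] at h1
    dsimp only at h1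
    congr 2
    ext
    omega

theorem IsSkeleton.isTreeEmb (h : IsEdgeTree root leaf src tgt)
    (hf : IsSkeleton root leaf src tgt s T f) :
    IsTreeEmb (h.bondParent s) none T.parent T.root
      ⟨bondMap src tgt s f, hf.bondMap_injective h⟩ := by
  refine ⟨rfl, fun β => ?_⟩
  rcases β with _ | ⟨j, r, hr⟩
  · rfl
  · have h1 := hf.bondMap_node h j (r + 1) hr
    have h2 := hf.bondMap_node h j r (Nat.le_of_succ_le hr)
    apply Subtype.ext
    change (bondMap src tgt s f (h.node s j (r + 1) hr)).1.dropLast =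
      (bondMap src tgt s f (h.node s j r _)).1
    have hl := hf.length j
    rw [h1, h2, List.dropLast_eq_take, List.take_take, List.length_take]
    congr 1
    omega

/-- Skeletons correspond to embeddings of the subdivided tree. -/
noncomputable def skeletonEquiv (h : IsEdgeTree root leaf src tgt) (s : E → ℕ) (T : PlaneTree) :
    {g : IsEdgeTree.Bond s ↪ T.Vertex // IsTreeEmb (h.bondParent s) none T.parent T.root g} ≃
      {f : W → T.Vertex // IsSkeleton root leaf src tgt s T f} := by
  refine Equiv.ofBijective (fun g => ⟨fun v => g.1 (h.top s v), isSkeleton_comp_top h g.2⟩)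
    ⟨fun g g' hgg => ?_, fun f => ⟨⟨⟨_, f.2.bondMap_injective h⟩, f.2.isTreeEmb h⟩, ?_⟩⟩
  · have hgg : ∀ v, g.1 (h.top s v) = g'.1 (h.top s v) := congrFun (congrArg Subtype.val hgg)
    apply Subtype.ext
    ext1 β
    rcases β with _ | ⟨j, r, hr⟩
    · rw [g.2.1, g'.2.1]
    · have h1 := prefix_node h g.2 j (s j) (r + 1) le_rfl hr
      have h2 := prefix_node h g'.2 j (s j) (r + 1) le_rfl hr
      rw [h.node_last] at h1 h2
      rw [hgg] at h1
      refine Subtype.ext (eq_of_prefix_of_length h1 h2 ?_)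
      have h3 := length_node h g.2 j (r + 1) hr
      have h4 := length_node h g'.2 j (r + 1) hr
      rw [hgg] at h3
      exact h3.trans h4.symm
  · exact Subtype.ext (funext fun v => f.2.bondMap_top h v)

end embeddings

/-! ### Shapes as edge trees, and compatibility as a skeleton -/

namespace Shape

variable {m : ℕ} (σ : Shape m)

instance finite_shapeVertex (m : ℕ) : Finite (ShapeVertex m) := by
  refine Finite.of_surjective (fun x : Option (Fin (m - 1) ⊕ Fin (m - 2)) => match x with
    | none => ShapeVertex.root
    | some (Sum.inl l) => ShapeVertex.leaf l
    | some (Sum.inr v) => ShapeVertex.internal v) fun v => ?_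
  cases v with
  | root => exact ⟨none, rfl⟩
  | leaf l => exact ⟨some (Sum.inl l), rfl⟩
  | internal v => exact ⟨some (Sum.inr v), rfl⟩

/-- The distance of a vertex of the shape from the vertex `0`. -/
noncomputable def depth (v : ShapeVertex m) : ℕ := σ.graph.dist ShapeVertex.root v

theorem depth_root : σ.depth ShapeVertex.root = 0 := SimpleGraph.dist_self

theorem depth_adj {v w : ShapeVertex m} (h : σ.graph.Adj v w) :
    σ.depth v = σ.depth w + 1 ∨ σ.depth w = σ.depth v + 1 :=
  σ.isTree.dist_eq_dist_add_one_of_adj _ h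

theorem exists_parent {v : ShapeVertex m} (hv : v ≠ ShapeVertex.root) :
    ∃ u, σ.graph.Adj u v ∧ σ.depth v = σ.depth u + 1 := by
  obtain ⟨p, hp⟩ := σ.isTree.connected.exists_walk_length_eq_dist v ShapeVertex.root
  cases p with
  | nil => exact absurd rfl hv
  | @cons _ u _ h q =>
    refine ⟨u, h.symm, (σ.depth_adj h).resolve_right fun h1 => ?_⟩
    have h2 := SimpleGraph.dist_le q
    rw [SimpleGraph.Walk.length_cons, SimpleGraph.dist_comm] at hp
    rw [SimpleGraph.dist_comm] at h2
    unfold depth at h1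
    omega

/-- Extending geodesics from the root to `u` and `u'` by one edge gives two paths to `v`; a tree has
only one, so the penultimate vertices agree. -/
theorem parent_unique {u u' v : ShapeVertex m} (h : σ.graph.Adj u v) (h' : σ.graph.Adj u' v)
    (hd : σ.depth v = σ.depth u + 1) (hd' : σ.depth v = σ.depth u' + 1) : u = u' := by
  obtain ⟨p, hp⟩ := σ.isTree.connected.exists_walk_length_eq_dist ShapeVertex.root u
  obtain ⟨p', hp'⟩ := σ.isTree.connected.exists_walk_length_eq_dist ShapeVertex.root u'
  have h1 : (p.concat h).IsPath := SimpleGraph.Walk.isPath_of_length_eq_dist _ (by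
    rw [SimpleGraph.Walk.length_concat, hp]; exact hd.symm)
  have h2 : (p'.concat h').IsPath := SimpleGraph.Walk.isPath_of_length_eq_dist _ (by
    rw [SimpleGraph.Walk.length_concat, hp']; exact hd'.symm)
  have h3 := (σ.isTree.existsUnique_path _ _).unique h1 h2
  have h4 := congrArg SimpleGraph.Walk.penultimate h3
  simpa using h4

theorem exists_isEdge (j : Fin (2 * m - 3)) : ∃ a b, σ.IsEdge j a b := by
  obtain ⟨e, he⟩ : ∃ e, e = (σ.edge j : Sym2 (ShapeVertex m)) := ⟨_, rfl⟩
  have hadj := (σ.edge j).2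
  rw [← he] at hadj
  induction e using Sym2.ind with
  | _ a b =>
    rcases σ.depth_adj hadj with h | h
    · exact ⟨b, a, by rw [← he, Sym2.eq_swap], h⟩
    · exact ⟨a, b, he.symm, h⟩

theorem exists_isEdge_of_adj {a b : ShapeVertex m} (h : σ.graph.Adj a b)
    (hd : σ.depth b = σ.depth a + 1) : ∃ j, σ.IsEdge j a b :=
  ⟨σ.edge.symm ⟨s(a, b), h⟩, by simp, hd⟩

/-- The endpoint of edge `j` closer to vertex `0`. -/
noncomputable def src (j : Fin (2 * m - 3)) : ShapeVertex m := (σ.exists_isEdge j).choose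

/-- The endpoint of edge `j` farther from vertex `0`. -/
noncomputable def tgt (j : Fin (2 * m - 3)) : ShapeVertex m :=
  (σ.exists_isEdge j).choose_spec.choose

theorem isEdge_src_tgt (j : Fin (2 * m - 3)) : σ.IsEdge j (σ.src j) (σ.tgt j) :=
  (σ.exists_isEdge j).choose_spec.choose_spec

theorem isEdge_iff {j : Fin (2 * m - 3)} {a b : ShapeVertex m} :
    σ.IsEdge j a b ↔ a = σ.src j ∧ b = σ.tgt j := by
  refine ⟨fun h => ?_, fun ⟨ha, hb⟩ => ha ▸ hb ▸ σ.isEdge_src_tgt j⟩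
  obtain ⟨h1, h2⟩ := h
  obtain ⟨h3, h4⟩ := σ.isEdge_src_tgt j
  rw [h1, Sym2.eq_iff] at h3
  rcases h3 with h3 | ⟨h5, h6⟩
  · exact h3
  · rw [h5, h6] at h2
    omega

theorem adj_src_tgt (j : Fin (2 * m - 3)) : σ.graph.Adj (σ.src j) (σ.tgt j) := by
  have := (σ.edge j).2
  rwa [(σ.isEdge_src_tgt j).1] at this

theorem depth_tgt (j : Fin (2 * m - 3)) : σ.depth (σ.tgt j) = σ.depth (σ.src j) + 1 :=
  (σ.isEdge_src_tgt j).2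

/-- The neighbour of the root is deeper than it. An internal vertex has at least two neighbours, of
which at most one is its parent. -/
theorem exists_src_eq (v : ShapeVertex m) (hv : ∀ l, v ≠ ShapeVertex.leaf l) :
    ∃ j, σ.src j = v := by
  suffices ∃ w, σ.graph.Adj v w ∧ σ.depth w = σ.depth v + 1 by
    obtain ⟨w, hw, hd⟩ := this
    obtain ⟨j, hj⟩ := σ.exists_isEdge_of_adj hw hd
    exact ⟨j, (σ.isEdge_iff.1 hj).1.symm⟩
  cases v with
  | root =>
    obtain ⟨w, hw⟩ := Set.ncard_eq_one.1 σ.degree_root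
    have hadj : w ∈ σ.graph.neighborSet ShapeVertex.root := hw ▸ rfl
    refine ⟨w, hadj, (σ.depth_adj hadj).resolve_left fun h => ?_⟩
    rw [depth_root] at h
    omega
  | leaf l => exact absurd rfl (hv l)
  | internal v =>
    obtain ⟨w, hw, w', hw', hne⟩ := (Set.one_lt_ncard (Set.toFinite _)).1
      (show 1 < (σ.graph.neighborSet (ShapeVertex.internal v)).ncard by
        rw [σ.degree_internal]; omega)
    rcases σ.depth_adj hw with h | h
    · rcases σ.depth_adj hw' with h' | h'
      · exact absurd (σ.parent_unique hw.symm hw'.symm h h') hne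
      · exact ⟨w', hw', h'⟩
    · exact ⟨w, hw, h⟩

theorem isEdgeTree : IsEdgeTree ShapeVertex.root ShapeVertex.leaf σ.src σ.tgt where
  tgt_injective j j' h := by
    have h1 : σ.src j = σ.src j' := σ.parent_unique (σ.adj_src_tgt j)
      (h ▸ σ.adj_src_tgt j') (σ.depth_tgt j) (h ▸ σ.depth_tgt j')
    apply σ.edge.injective
    apply Subtype.ext
    rw [(σ.isEdge_src_tgt j).1, (σ.isEdge_src_tgt j').1, h1, h]
  tgt_ne_root j h := by
    have := σ.depth_tgt j
    rw [h, depth_root] at this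
    omega
  induction P h0 h1 v := by
    induction hn : σ.depth v generalizing v with
    | zero =>
      rcases eq_or_ne v ShapeVertex.root with rfl | hv
      · exact h0
      · obtain ⟨u, -, hu⟩ := σ.exists_parent hv
        omega
    | succ n ih =>
      have hv : v ≠ ShapeVertex.root := by
        rintro rfl
        rw [depth_root] at hn
        omega
      obtain ⟨u, hadj, hu⟩ := σ.exists_parent hv
      obtain ⟨j, hj⟩ := σ.exists_isEdge_of_adj hadj hu
      obtain ⟨rfl, rfl⟩ := σ.isEdge_iff.1 hj
      exact h1 j (ih _ (by omega))
  leaf_induction P h0 h1 v := by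
    -- Depth is bounded, so induction on `M - depth` runs from the deepest vertices towards the
    -- root.
    obtain ⟨M, hM⟩ := (Set.finite_range σ.depth).bddAbove
    have hM' : ∀ v, σ.depth v ≤ M := fun v => hM ⟨v, rfl⟩
    induction hn : M - σ.depth v using Nat.strong_induction_on generalizing v with
    | _ n ih =>
      by_cases hv : ∃ l, v = ShapeVertex.leaf l
      · obtain ⟨l, rfl⟩ := hv
        exact h0 l
      · push Not at hv
        obtain ⟨j, rfl⟩ := σ.exists_src_eq v hv
        have h2 := σ.depth_tgt j
        have h3 := hM' (σ.tgt j)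
        exact h1 j (ih _ (by omega) _ rfl)

end Shape

theorem compatible_iff {d m : ℕ} {T : PlaneTree} {φ : T.Embedding d}
    {i : Fin (m - 1) → T.Vertex} {σ : Shape m} {y : Fin (2 * m - 3) → Fin d → ℤ}
    {s : Fin (2 * m - 3) → ℕ} :
    Compatible T φ i σ y s ↔ ∃ f : ShapeVertex m → T.Vertex,
      IsSkeleton ShapeVertex.root ShapeVertex.leaf σ.src σ.tgt s T f ∧
      (∀ l, f (ShapeVertex.leaf l) = i l) ∧
      (fun j => φ.pos (f (σ.tgt j)) - φ.pos (f (σ.src j))) = y := by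
  have ex : ∀ (P : ShapeVertex m → ShapeVertex m → Prop) j,
      (∃ a b, σ.IsEdge j a b ∧ P a b) ↔ P (σ.src j) (σ.tgt j) := fun P j => by
    refine ⟨fun ⟨a, b, h, hP⟩ => ?_, fun h => ⟨_, _, σ.isEdge_src_tgt j, h⟩⟩
    obtain ⟨rfl, rfl⟩ := σ.isEdge_iff.1 h
    exact hP
  constructor
  · rintro ⟨f, h0, hl, h1, h2⟩
    have h1' := fun j => h1 j _ _ (σ.isEdge_src_tgt j)
    refine ⟨f, ⟨h0, fun j => (h1' j).1, fun j => (h1' j).2.1, fun w hw hr => ?_⟩, hl,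
      funext fun j => (h1' j).2.2⟩
    have := h2 w (Or.inr (by simpa only [← hl] using hw)) hr
    simpa only [ex (fun a b => w ∈ T.pathBonds (f a) (f b))] using this
  · rintro ⟨f, hf, hl, hy⟩
    refine ⟨f, hf.map_root, hl, fun j a b hab => ?_, fun w hw hr => ?_⟩
    · obtain ⟨rfl, rfl⟩ := σ.isEdge_iff.1 hab
      exact ⟨hf.isPrefix j, hf.length j, congrFun hy j⟩
    · simp only [ex (fun a b => w ∈ T.pathBonds (f a) (f b))]
      refine hf.existsUnique w ?_ hr
      simpa only [hl] using hw.resolve_left hr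

/-! ### Independent steps and the Fourier transform -/

/-- Independence of the steps: the sum factors over `α`. Each fibre of `g` is a singleton or empty,
giving a factor `|U| * D b` or just `|U|`. -/
theorem sum_prod_comp_embedding {α β U : Type} [Fintype α] [DecidableEq α] [Fintype β] [Fintype U]
    (g : β ↪ α) (ψ : β → U → ℂ) (D : β → ℂ) (hD : ∀ b, ∑ u, ψ b u = Fintype.card U * D b) :
    ∑ st : α → U, ∏ b, ψ b (st (g b)) = (Fintype.card U : ℂ) ^ Fintype.card α * ∏ b, D b := by
  classical
  have h1 : ∀ st : α → U, ∏ b, ψ b (st (g b)) =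
      ∏ a, ∏ b with g b = a, ψ b (st a) := fun st => by
    rw [← Finset.prod_fiberwise (s := Finset.univ) (g := fun b => g b)]
    refine Finset.prod_congr rfl fun a _ => Finset.prod_congr rfl fun b hb => ?_
    rw [(Finset.mem_filter.1 hb).2]
  have h2 : ∀ a, ∑ u, ∏ b with g b = a, ψ b u =
      Fintype.card U * ∏ b with g b = a, D b := fun a => by
    by_cases ha : ∃ b, g b = a
    · obtain ⟨b, rfl⟩ := ha
      have : Finset.univ.filter (fun b' => g b' = g b) = {b} := by
        ext b'
        simp
      simp only [this, Finset.prod_singleton, hD]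
    · have : Finset.univ.filter (fun b' => g b' = a) = ∅ :=
        Finset.filter_eq_empty_iff.2 fun b _ hb => ha ⟨b, hb⟩
      simp [this]
  simp_rw [h1]
  rw [← Fintype.prod_sum (fun a u => ∏ b with g b = a, ψ b u)]
  simp_rw [h2]
  rw [Finset.prod_mul_distrib, Finset.prod_const, Finset.card_univ,
    Finset.prod_fiberwise (s := Finset.univ) (g := fun b => g b)]

/-- The steps to the nearest neighbours in `ℤ^d`. -/
def unitStep (d : ℕ) (x : Fin d × Bool) : Fin d → ℤ := Pi.single x.1 (if x.2 then 1 else -1)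

theorem sum_abs_unitStep (d : ℕ) (x : Fin d × Bool) : ∑ i, |unitStep d x i| = 1 := by
  rw [Finset.sum_eq_single x.1]
  · rcases x with ⟨c, _ | _⟩ <;> simp [unitStep]
  · intro i _ hi
    simp [unitStep, Pi.single_eq_of_ne hi]
  · simp

theorem unitStep_injective (d : ℕ) : Function.Injective (unitStep d) := by
  have h0 : ∀ b : Bool, (if b then (1 : ℤ) else -1) ≠ 0 := by decide
  have h1 : Function.Injective (fun b : Bool => if b then (1 : ℤ) else -1) := by decide
  rintro ⟨c, b⟩ ⟨c', b'⟩ h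
  have hc := congrFun h c
  simp only [unitStep, Pi.single_eq_same] at hc
  by_cases hcc : c = c'
  · subst hcc
    rw [Pi.single_eq_same] at hc
    rw [h1 hc]
  · rw [Pi.single_eq_of_ne hcc] at hc
    exact absurd hc (h0 b)

theorem exists_unitStep_eq {d : ℕ} {v : Fin d → ℤ} (hv : ∑ i, |v i| = 1) :
    ∃ x, unitStep d x = v := by
  obtain ⟨c, hc⟩ : ∃ c, v c ≠ 0 := by
    by_contra h
    push Not at h
    simp [h] at hv
  have h1 : ∑ i ∈ Finset.univ.erase c, |v i| + |v c| = 1 := by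
    rw [Finset.sum_erase_add _ _ (Finset.mem_univ c), hv]
  have h2 : 0 ≤ ∑ i ∈ Finset.univ.erase c, |v i| := Finset.sum_nonneg fun i _ => abs_nonneg _
  have h3 : 1 ≤ |v c| := Int.one_le_abs hc
  have h4 : ∑ i ∈ Finset.univ.erase c, |v i| = 0 := by omega
  have h5 : |v c| = 1 := by omega
  have h6 : ∀ i, i ≠ c → v i = 0 := fun i hi => by
    have := (Finset.sum_eq_zero_iff_of_nonneg fun i _ => abs_nonneg (v i)).1 h4 i
      (Finset.mem_erase.2 ⟨hi, Finset.mem_univ i⟩)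
    exact abs_eq_zero.1 this
  refine ⟨(c, decide (v c = 1)), funext fun i => ?_⟩
  by_cases hi : i = c
  · subst hi
    rcases (abs_eq (zero_le_one' ℤ)).1 h5 with h | h <;> simp [unitStep, h]
  · rw [h6 i hi]
    simp [unitStep, Pi.single_eq_of_ne hi]

namespace PlaneTree

/-- The vertices of a plane tree other than the root. -/
abbrev NonRoot (T : PlaneTree) : Type := {w : T.Vertex // w ≠ T.root}

theorem card_nonRoot (T : PlaneTree) [Fintype T.NonRoot] : Fintype.card T.NonRoot = T.size - 1 := by
  classical
  rw [← T.card_vertex, ← Nat.card_eq_fintype_card, ← Nat.card_eq_fintype_card]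
  have := Set.ncard_sdiff_singleton_of_mem (Set.mem_univ T.root)
  rw [Set.ncard_univ] at this
  rw [← this, ← Nat.card_coe_set_eq]
  exact Nat.card_congr (Equiv.subtypeEquivRight fun w => by simp)

theorem parent_child {T : PlaneTree} {v w : T.Vertex} {a : ℕ} (h : w.1 = v.1 ++ [a]) :
    w ≠ T.root ∧ T.parent w = v := by
  refine ⟨fun hw => ?_, Subtype.ext ?_⟩
  · rw [hw] at h
    simp [root] at h
  · simp [parent, h]

namespace Embedding

variable {T : PlaneTree} {d : ℕ}

theorem sum_abs_step (φ : T.Embedding d) (w : T.NonRoot) :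
    ∑ i, |(φ.pos w - φ.pos (T.parent w)) i| = 1 :=
  φ.pos_adj _ _ _ ((T.ne_root_iff w.1).1 w.2)

/-- The step of the embedding along the bond from the parent of `w` to `w`. -/
noncomputable def step (φ : T.Embedding d) (w : T.NonRoot) : Fin d × Bool :=
  (exists_unitStep_eq (φ.sum_abs_step w)).choose

theorem unitStep_step (φ : T.Embedding d) (w : T.NonRoot) :
    unitStep d (φ.step w) = φ.pos w - φ.pos (T.parent w) :=
  (exists_unitStep_eq (φ.sum_abs_step w)).choose_spec

theorem pos_injective : Function.Injective (pos : T.Embedding d → _) := by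
  rintro ⟨⟩ ⟨⟩ h
  cases h
  rfl

/-- Positions are recovered by adding steps from the root. Thus summing over embeddings is summing
over free choices of a step at each nonroot vertex. -/
theorem step_bijective : Function.Bijective (step : T.Embedding d → _) := by
  refine ⟨fun φ φ' h => pos_injective (funext fun v => ?_), fun st => ?_⟩
  · refine T.isRootedTree.induction (P := fun v => φ.pos v = φ'.pos v)
      (φ.pos_root.trans φ'.pos_root.symm) (fun v hv ih => ?_) v
    have h1 := φ.unitStep_step ⟨v, hv⟩
    have h2 := φ'.unitStep_step ⟨v, hv⟩
    rw [h, h2] at h1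
    dsimp only at h1
    rw [ih] at h1
    exact (sub_left_injective h1).symm
  · classical
    obtain ⟨F, h0, h1⟩ := T.isRootedTree.exists_rec (0 : Fin d → ℤ)
      (fun v x => if hv : v ≠ T.root then x + unitStep d (st ⟨v, hv⟩) else x)
    have h2 : ∀ w : T.NonRoot, F w - F (T.parent w) = unitStep d (st w) := fun w => by
      rw [h1 w w.2]
      simp [w.2]
    let φ : T.Embedding d :=
      { pos := F
        pos_root := h0
        pos_adj := fun v w a h => by
          obtain ⟨hw, hp⟩ := parent_child h
          have := h2 ⟨w, hw⟩
          dsimp only at this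
          rw [hp] at this
          have h3 : ∀ i, F w i - F v i = unitStep d (st ⟨w, hw⟩) i := fun i => congrFun this i
          simp_rw [h3]
          exact sum_abs_unitStep d _ }
    refine ⟨φ, funext fun w => unitStep_injective d ?_⟩
    rw [φ.unitStep_step, ← h2]

instance : Finite (T.Embedding d) := Finite.of_injective _ step_bijective.injective

end Embedding

end PlaneTree

/-- The Fourier transform of the one-step distribution of simple random walk. -/
noncomputable def stepChar {d : ℕ} (κ : EuclideanSpace ℝ (Fin d)) : ℝ :=
  (∑ c, Real.cos (κ c)) / d

/-- The character of `ℤ^d` with frequency `κ`. -/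
noncomputable def latticeChar {d : ℕ} (κ : EuclideanSpace ℝ (Fin d)) (x : Fin d → ℤ) : ℂ :=
  Complex.exp (Complex.I * ((∑ c, κ c * (x c : ℝ) : ℝ) : ℂ))

theorem latticeChar_sum {d : ℕ} (κ : EuclideanSpace ℝ (Fin d)) {ι : Type} (S : Finset ι)
    (x : ι → Fin d → ℤ) : latticeChar κ (∑ i ∈ S, x i) = ∏ i ∈ S, latticeChar κ (x i) := by
  simp only [latticeChar]
  rw [← Complex.exp_sum, ← Finset.mul_sum, ← Complex.ofReal_sum, Finset.sum_comm]
  simp only [Finset.sum_apply, Int.cast_sum, Finset.mul_sum]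

theorem sum_latticeChar {d : ℕ} (hd : 1 ≤ d) (κ : EuclideanSpace ℝ (Fin d)) :
    ∑ x, latticeChar κ (unitStep d x) = Fintype.card (Fin d × Bool) * (stepChar κ : ℂ) := by
  have h : ∀ c b, ∑ i, κ i * (unitStep d (c, b) i : ℝ) = κ c * (if b then 1 else -1) := by
    intro c b
    rw [Finset.sum_eq_single c]
    · cases b <;> simp [unitStep]
    · intro i _ hi
      simp [unitStep, Pi.single_eq_of_ne hi]
    · simp
  have hd' : (d : ℂ) ≠ 0 := by exact_mod_cast (by omega : d ≠ 0)
  rw [Fintype.sum_prod_type]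
  simp only [latticeChar, h, Fintype.sum_bool, stepChar, Fintype.card_prod, Fintype.card_fin,
    Fintype.card_bool]
  push_cast
  field_simp
  rw [Finset.mul_sum]
  refine Finset.sum_congr rfl fun c _ => ?_
  have := Complex.two_cos (κ c : ℂ)
  rw [this]
  congr 2 <;> ring_nf

section fourier

variable {W E L : Type} [Fintype E] {root : W} {leaf : L → W} {src tgt : E → W} {s : E → ℕ}
  {T : PlaneTree}

theorem prod_latticeChar {d : ℕ} (h : IsEdgeTree root leaf src tgt) {f : W → T.Vertex}
    (hf : IsSkeleton root leaf src tgt s T f) (κ : E → EuclideanSpace ℝ (Fin d))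
    (φ : T.Embedding d) (g : (Σ j, Fin (s j)) ↪ T.NonRoot)
    (hg : ∀ x, (g x : T.Vertex) = bondMap src tgt s f (some x)) :
    ∏ j, latticeChar (κ j) (φ.pos (f (tgt j)) - φ.pos (f (src j))) =
      ∏ x : Σ j, Fin (s j), latticeChar (κ x.1) (unitStep d (φ.step (g x))) := by
  rw [Fintype.prod_sigma]
  refine Finset.prod_congr rfl fun j _ => ?_
  dsimp only
  rw [← latticeChar_sum]
  congr 1
  have := h.sum_telescope s (fun β => φ.pos (bondMap src tgt s f β)) j
  simp only [hf.bondMap_top h] at this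
  rw [← this]
  refine Finset.sum_congr rfl fun r _ => ?_
  have h2 := (hf.isTreeEmb h).2 (some ⟨j, r⟩)
  rw [φ.unitStep_step, hg]
  congr 2
  exact h2.symm

/-- Distinct bonds carry independent steps, so each bond of edge `j` contributes `stepChar (κ j)`;
the power of `2d` cancels the denominator of `configWeight`. -/
theorem sum_embedding_latticeChar {d : ℕ} (hd : 1 ≤ d) (h : IsEdgeTree root leaf src tgt)
    {f : W → T.Vertex} (hf : IsSkeleton root leaf src tgt s T f)
    (κ : E → EuclideanSpace ℝ (Fin d)) [Fintype (T.Embedding d)] :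
    ∑ φ : T.Embedding d, ∏ j, latticeChar (κ j) (φ.pos (f (tgt j)) - φ.pos (f (src j))) =
      (2 * d : ℂ) ^ (T.size - 1) * ∏ j, (stepChar (κ j) : ℂ) ^ s j := by
  classical
  let G : IsEdgeTree.Bond s ↪ T.Vertex := ⟨bondMap src tgt s f, hf.bondMap_injective h⟩
  let g : (Σ j, Fin (s j)) ↪ T.NonRoot :=
    ⟨fun x => ⟨G (some x), fun hx => Option.some_ne_none x (G.injective hx)⟩,
      fun x y hxy => Option.some_injective _ (G.injective (congrArg Subtype.val hxy))⟩
  simp_rw [prod_latticeChar h hf κ _ g (fun _ => rfl)]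
  rw [(PlaneTree.Embedding.step_bijective (T := T) (d := d)).sum_comp
    (fun st => ∏ x : Σ j, Fin (s j), latticeChar (κ x.1) (unitStep d (st (g x)))),
    sum_prod_comp_embedding g (fun x u => latticeChar (κ x.1) (unitStep d u))
      (fun x => (stepChar (κ x.1) : ℂ)) (fun x => sum_latticeChar hd (κ x.1)),
    T.card_nonRoot, Fintype.prod_sigma]
  simp [mul_comm]

end fourier

open Classical in
theorem sum_compatible {d m : ℕ} (T : PlaneTree) (φ : T.Embedding d) (σ : Shape m)
    (y : Fin (2 * m - 3) → Fin d → ℤ) (s : Fin (2 * m - 3) → ℕ)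
    [Fintype {f : ShapeVertex m → T.Vertex //
      IsSkeleton ShapeVertex.root ShapeVertex.leaf σ.src σ.tgt s T f}] :
    (∑ i : Fin (m - 1) → T.Vertex, if Compatible T φ i σ y s then (1 : ℝ) else 0) =
      ∑ f : {f : ShapeVertex m → T.Vertex //
        IsSkeleton ShapeVertex.root ShapeVertex.leaf σ.src σ.tgt s T f},
        if (fun j => φ.pos (f.1 (σ.tgt j)) - φ.pos (f.1 (σ.src j))) = y then 1 else 0 := by
  simp only [← Finset.sum_filter, Finset.sum_const, nsmul_eq_mul, mul_one]
  congr 1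
  symm
  refine Finset.card_bij (fun f _ l => f.1 (ShapeVertex.leaf l)) (fun f hf => ?_)
    (fun f _ f' _ h => ?_) (fun i hi => ?_)
  · exact Finset.mem_filter.2 ⟨Finset.mem_univ _, compatible_iff.2
      ⟨f.1, f.2, fun _ => rfl, (Finset.mem_filter.1 hf).2⟩⟩
  · exact Subtype.ext (f.2.ext_leaf σ.isEdgeTree f'.2 (congrFun h))
  · obtain ⟨f, hf, hl, hy⟩ := compatible_iff.1 (Finset.mem_filter.1 hi).2
    exact ⟨⟨f, hf⟩, Finset.mem_filter.2 ⟨Finset.mem_univ _, hy⟩, funext hl⟩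

/-- The weighted number of copies of `B` in the plane trees of size `n`. -/
noncomputable def copyWeight {B : Type} (pB : B → B) (b₀ : B) (n : ℕ) : ℝ :=
  ∑' T : {T : PlaneTree // T.size = n},
    T.1.weight * Nat.card {h : B ↪ T.1.Vertex // IsTreeEmb pB b₀ T.1.parent T.1.root h}

/-- For a fixed tree, embedding and skeleton exactly one `y` contributes. The embedding average does
not depend on the skeleton, so only the number of skeletons remains. -/
theorem mPointFourier_eq {d : ℕ} (hd : 1 ≤ d) {m : ℕ} (n : ℕ) (σ : Shape m)
    (k : Fin (2 * m - 3) → EuclideanSpace ℝ (Fin d)) (s : Fin (2 * m - 3) → ℕ) :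
    mPointFourier d m n σ k s =
      ((copyWeight (σ.isEdgeTree.bondParent s) none n * ∏ j, stepChar (k j) ^ s j : ℝ) : ℂ) := by
  classical
  have := Fintype.ofFinite {T : PlaneTree // T.size = n}
  have := fun T : PlaneTree => Fintype.ofFinite (T.Embedding d)
  have := fun T : PlaneTree => Fintype.ofFinite {f : ShapeVertex m → T.Vertex //
      IsSkeleton ShapeVertex.root ShapeVertex.leaf σ.src σ.tgt s T f}
  let disp : ∀ T : PlaneTree, T.Embedding d → {f : ShapeVertex m → T.Vertex //
      IsSkeleton ShapeVertex.root ShapeVertex.leaf σ.src σ.tgt s T f} →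
      Fin (2 * m - 3) → Fin d → ℤ :=
    fun T φ f j => φ.pos (f.1 (σ.tgt j)) - φ.pos (f.1 (σ.src j))
  let χ : (Fin (2 * m - 3) → Fin d → ℤ) → ℂ := fun y => ∏ j, latticeChar (k j) (y j)
  have hχ : ∀ y : Fin (2 * m - 3) → Fin d → ℤ,
      Complex.exp (Complex.I * ((∑ j, ∑ c, k j c * (y j c : ℝ) : ℝ) : ℂ)) = χ y := fun y => by
    simp only [χ, latticeChar]
    rw [← Complex.exp_sum, ← Finset.mul_sum, ← Complex.ofReal_sum]
  have hm : ∀ y, (mPoint d m n σ y s : ℂ) * χ y = ∑ T : {T : PlaneTree // T.size = n},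
      ∑ φ : T.1.Embedding d, ∑ f,
        (if y = disp T.1 φ f then (T.1.configWeight d : ℂ) * χ (disp T.1 φ f) else 0) := by
    intro y
    rw [mPoint, tsum_fintype, Complex.ofReal_sum, Finset.sum_mul]
    refine Finset.sum_congr rfl fun T _ => ?_
    rw [tsum_fintype, Complex.ofReal_sum, Finset.sum_mul]
    refine Finset.sum_congr rfl fun φ _ => ?_
    rw [sum_compatible, Complex.ofReal_mul, Complex.ofReal_sum, Finset.mul_sum, Finset.sum_mul]
    refine Finset.sum_congr rfl fun f _ => ?_
    by_cases h : y = disp T.1 φ f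
    · rw [if_pos h, if_pos h.symm, h]
      simp
    · rw [if_neg h, if_neg (Ne.symm h)]
      simp
  have hsum : HasSum (fun y => (mPoint d m n σ y s : ℂ) * χ y)
      (∑ T : {T : PlaneTree // T.size = n}, ∑ φ : T.1.Embedding d, ∑ f,
        (T.1.configWeight d : ℂ) * χ (disp T.1 φ f)) := by
    simp_rw [hm]
    exact hasSum_sum fun T _ => hasSum_sum fun φ _ => hasSum_sum fun f _ => hasSum_ite_eq _ _
  rw [mPointFourier]
  simp_rw [hχ]
  rw [hsum.tsum_eq, copyWeight, tsum_fintype, Finset.sum_mul, Complex.ofReal_sum]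
  refine Finset.sum_congr rfl fun T _ => ?_
  rw [Finset.sum_comm]
  simp_rw [← Finset.mul_sum]
  simp only [χ, disp]
  rw [Finset.sum_congr rfl fun f _ => sum_embedding_latticeChar hd σ.isEdgeTree f.2 k,
    Finset.sum_const, Finset.card_univ, ← Nat.card_eq_fintype_card,
    ← Nat.card_congr (skeletonEquiv σ.isEdgeTree s T.1), PlaneTree.configWeight]
  have hd' : (d : ℂ) ≠ 0 := by exact_mod_cast (by omega : d ≠ 0)
  push_cast
  rw [nsmul_eq_mul]
  field_simp

/-! ### Asymptotics of the exact formula -/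

/-- `copyWeight` in the form suited to the limit `n → ∞`. -/
theorem copyWeight_eq {B : Type} [Finite B] {pB : B → B} {b₀ : B} (hB : IsRootedTree pB b₀)
    {n : ℕ} (hn : Nat.card B ≤ n) :
    n * copyWeight pB b₀ n = (Nat.card B / Real.sqrt n) *
      (n.descFactorial (Nat.card B) / (n : ℝ) ^ Nat.card B) *
      (Real.sqrt n * (n / Real.exp 1) ^ n / n.factorial) := by
  have := Fintype.ofFinite {T : PlaneTree // T.size = n}
  have h := sum_weight_mul_card_emb hB n
  have : Nonempty B := ⟨b₀⟩
  have hpos : 0 < n := lt_of_lt_of_le Nat.card_pos hn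
  have hn0 : (n : ℝ) ≠ 0 := by exact_mod_cast hpos.ne'
  have hs : Real.sqrt n ≠ 0 := (Real.sqrt_pos.2 (by exact_mod_cast hpos)).ne'
  have hf : (n.factorial : ℝ) ≠ 0 := by exact_mod_cast n.factorial_ne_zero
  have hp : (n : ℝ) ^ n = (n : ℝ) ^ (n - Nat.card B) * (n : ℝ) ^ Nat.card B := by
    rw [← pow_add, Nat.sub_add_cancel hn]
  have he : Real.exp (-1) ^ n * Real.exp 1 ^ n = 1 := by
    rw [← mul_pow, ← Real.exp_add]
    simp
  rw [copyWeight, tsum_fintype]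
  generalize ∑ T : {T : PlaneTree // T.size = n}, T.1.weight * (Nat.card {h : B ↪ T.1.Vertex //
    IsTreeEmb pB b₀ T.1.parent T.1.root h} : ℝ) = S at h ⊢
  rw [div_pow, hp]
  have he0 : Real.exp 1 ^ n ≠ 0 := (pow_pos (Real.exp_pos 1) n).ne'
  field_simp
  linear_combination Real.exp 1 ^ n * h +
    ((n.descFactorial (Nat.card B) : ℝ) * Nat.card B * (n : ℝ) ^ (n - Nat.card B)) * he

open Filter Topology in
-- Squeeze by `exp (x / (1 + x)) ≤ 1 + x ≤ exp x`, valid for either sign of `x` once `1 + x > 0`.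
theorem tendsto_one_add_pow {x : ℕ → ℝ} {N : ℕ → ℕ} {t : ℝ} (hx : Tendsto x atTop (𝓝 0))
    (hN : Tendsto (fun n => N n * x n) atTop (𝓝 t)) :
    Tendsto (fun n => (1 + x n) ^ N n) atTop (𝓝 (Real.exp t)) := by
  have h1 : Tendsto (fun n => 1 + x n) atTop (𝓝 1) := by simpa using hx.const_add 1
  have hlow : Tendsto (fun n => Real.exp (N n * x n / (1 + x n))) atTop (𝓝 (Real.exp t)) := by
    have := (Real.continuous_exp.tendsto _).comp (hN.div h1 one_ne_zero)
    simpa [Function.comp_def] using this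
  have hup := (Real.continuous_exp.tendsto _).comp hN
  have hpos : ∀ᶠ n in atTop, 0 < 1 + x n := h1.eventually_const_lt one_pos
  refine tendsto_of_tendsto_of_tendsto_of_le_of_le' hlow hup ?_ ?_
  · filter_upwards [hpos] with n hn
    rw [mul_div_assoc, Real.exp_nat_mul]
    refine pow_le_pow_left₀ (Real.exp_pos _).le ?_ _
    have h2 : 1 - x n / (1 + x n) = (1 + x n)⁻¹ := by
      field_simp
      ring
    have h3 := Real.one_sub_le_exp_neg (x n / (1 + x n))
    rw [h2, Real.exp_neg] at h3
    exact (inv_le_inv₀ hn (Real.exp_pos _)).1 h3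
  · filter_upwards [hpos] with n hn
    simp only [Function.comp]
    rw [Real.exp_nat_mul]
    refine pow_le_pow_left₀ hn.le ?_ _
    rw [add_comm]
    exact Real.add_one_le_exp _

theorem descFactorial_div_pow {n : ℕ} (hn : n ≠ 0) {b : ℕ} (hb : b ≤ n) :
    (n.descFactorial b : ℝ) / (n : ℝ) ^ b = ∏ i ∈ Finset.range b, (1 - (i : ℝ) / n) := by
  have hn' : (n : ℝ) ≠ 0 := by exact_mod_cast hn
  rw [Nat.descFactorial_eq_prod_range, Nat.cast_prod, ← Finset.card_range b, ← Finset.prod_const,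
    Finset.card_range, ← Finset.prod_div_distrib]
  refine Finset.prod_congr rfl fun i hi => ?_
  rw [Nat.cast_sub ((Finset.mem_range.1 hi).le.trans hb)]
  field_simp

theorem sum_range_div (n b : ℕ) :
    ∑ i ∈ Finset.range b, (i : ℝ) / n = b * (b - 1) / (2 * n) := by
  induction b with
  | zero => simp
  | succ b ih =>
    rw [Finset.sum_range_succ, ih]
    push_cast
    rcases eq_or_ne (n : ℝ) 0 with h | h
    · simp [h]
    · field_simp
      ring

open Filter Topology in
-- The ratio is `∏ (1 - i/n)` over `i < b`. With `y = b/n`, each factor lies between `exp (-(i/n) /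
-- (1 - y))` and `exp (-i/n)`; here `∑ i/n = b(b-1)/(2n) → U²/2` and `y → 0`.
theorem tendsto_descFactorial_div_pow {b : ℕ → ℕ} {U : ℝ}
    (hb : Tendsto (fun n => (b n : ℝ) / Real.sqrt n) atTop (𝓝 U)) :
    Tendsto (fun n : ℕ => (n.descFactorial (b n) : ℝ) / (n : ℝ) ^ b n) atTop
      (𝓝 (Real.exp (-U ^ 2 / 2))) := by
  have hinv : Tendsto (fun n : ℕ => (Real.sqrt n)⁻¹) atTop (𝓝 0) :=
    (Real.tendsto_sqrt_atTop.comp tendsto_natCast_atTop_atTop).inv_tendsto_atTop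
  have hs : ∀ n : ℕ, (n : ℝ) = Real.sqrt n * Real.sqrt n := fun n =>
    (Real.mul_self_sqrt n.cast_nonneg).symm
  have hbn : Tendsto (fun n => (b n : ℝ) / n) atTop (𝓝 0) := by
    have := hb.mul hinv
    rw [mul_zero] at this
    refine this.congr fun n => ?_
    conv_rhs => rw [hs n]
    rw [div_mul_eq_div_div, div_eq_mul_inv (_ / _)]
  have hsum : Tendsto (fun n => (b n : ℝ) * (b n - 1) / (2 * n)) atTop (𝓝 (U ^ 2 / 2)) := by
    have := (hb.mul (hb.sub hinv)).div_const 2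
    rw [sub_zero, ← sq] at this
    refine this.congr fun n => ?_
    conv_rhs => rw [hs n]
    rw [← one_div, ← sub_div, div_mul_div_comm, div_div, mul_comm 2]
  have hup : Tendsto (fun n => Real.exp (-((b n : ℝ) * (b n - 1) / (2 * n)))) atTop
      (𝓝 (Real.exp (-U ^ 2 / 2))) := by
    have := (Real.continuous_exp.tendsto _).comp hsum.neg
    rwa [← neg_div] at this
  have hlow : Tendsto (fun n => Real.exp (-((b n : ℝ) * (b n - 1) / (2 * n) / (1 - b n / n))))
      atTop (𝓝 (Real.exp (-U ^ 2 / 2))) := by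
    have := (Real.continuous_exp.tendsto _).comp
      (hsum.div (hbn.const_sub 1) (by norm_num)).neg
    rwa [sub_zero, div_one, ← neg_div] at this
  have hev : ∀ᶠ n in atTop, (b n : ℝ) / n < 1 ∧ n ≠ 0 :=
    (hbn.eventually_lt_const one_pos).and (eventually_ne_atTop 0)
  refine tendsto_of_tendsto_of_tendsto_of_le_of_le' hlow hup ?_ ?_
  all_goals
    filter_upwards [hev] with n ⟨hlt, hn0⟩
    have hnpos : (0 : ℝ) < n := by exact_mod_cast Nat.pos_of_ne_zero hn0
    have hle : b n ≤ n := by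
      rw [div_lt_one hnpos] at hlt
      exact_mod_cast hlt.le
    have hi : ∀ i ∈ Finset.range (b n), (i : ℝ) / n ≤ b n / n := fun i hi => by
      have : (i : ℝ) ≤ b n := by exact_mod_cast (Finset.mem_range.1 hi).le
      gcongr
    rw [descFactorial_div_pow hn0 hle, ← sum_range_div]
  · rw [Finset.sum_div, ← Finset.sum_neg_distrib, Real.exp_sum]
    refine Finset.prod_le_prod (fun i _ => (Real.exp_pos _).le) fun i hir => ?_
    have h1 := hi i hir
    have h0 : 0 ≤ (i : ℝ) / n := by positivity
    set x := (i : ℝ) / n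
    set y := (b n : ℝ) / n
    have h2 : (1 - x)⁻¹ ≤ Real.exp (x / (1 - y)) := by
      have h3 : (1 - x)⁻¹ = 1 + x / (1 - x) := by
        have : 1 - x ≠ 0 := by linarith
        field_simp
        ring
      have h4 : x / (1 - x) ≤ x / (1 - y) :=
        div_le_div_of_nonneg_left h0 (by linarith) (by linarith)
      have h5 := Real.add_one_le_exp (x / (1 - y))
      linarith
    rw [Real.exp_neg]
    exact inv_le_of_inv_le₀ (by linarith) h2
  · rw [← Finset.sum_neg_distrib, Real.exp_sum]
    refine Finset.prod_le_prod (fun i hir => ?_) fun i _ => Real.one_sub_le_exp_neg _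
    have := hi i hir
    linarith

open Filter Topology in
theorem tendsto_stirling :
    Tendsto (fun n : ℕ => Real.sqrt n * (n / Real.exp 1) ^ n / n.factorial) atTop
      (𝓝 (1 / Real.sqrt (2 * Real.pi))) := by
  have h := (Stirling.tendsto_stirlingSeq_sqrt_pi.inv₀
    (Real.sqrt_pos.2 Real.pi_pos).ne').div_const (Real.sqrt 2)
  rw [show (Real.sqrt Real.pi)⁻¹ / Real.sqrt 2 = 1 / Real.sqrt (2 * Real.pi) by
    rw [Real.sqrt_mul zero_le_two, one_div, mul_inv, div_eq_mul_inv, mul_comm]] at h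
  refine h.congr fun n => ?_
  have h2 : Real.sqrt 2 ≠ 0 := by positivity
  rw [Stirling.stirlingSeq, inv_div, Real.sqrt_mul zero_le_two]
  field_simp

open Filter Topology in
theorem tendsto_floor_div {u : ℝ} (hu : 0 ≤ u) :
    Tendsto (fun n : ℕ => (⌊u * Real.sqrt n⌋₊ : ℝ) / Real.sqrt n) atTop (𝓝 u) :=
  (tendsto_nat_floor_mul_div_atTop hu).comp
    (Real.tendsto_sqrt_atTop.comp tendsto_natCast_atTop_atTop)

open Filter Topology in
-- Write `cos θ - 1 = -2 sin² (θ/2)` and use that `sin (a t) / t → a` at `t = n^(-1/4)`, where `√n =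
-- t⁻²`. The scaling by `√d` compensates the average over `d` coordinates.
theorem tendsto_sqrt_mul_stepChar_sub_one {d : ℕ} (hd : 1 ≤ d) (k : EuclideanSpace ℝ (Fin d)) :
    Tendsto (fun n : ℕ => Real.sqrt n *
      (stepChar ((Real.sqrt (d : ℝ) * (n : ℝ) ^ (-(1 / 4) : ℝ)) • k) - 1)) atTop
      (𝓝 (-‖k‖ ^ 2 / 2)) := by
  have hd' : (d : ℝ) ≠ 0 := by exact_mod_cast (by omega : d ≠ 0)
  have ht : Tendsto (fun n : ℕ => (n : ℝ) ^ (-(1 / 4) : ℝ)) atTop (𝓝[>] 0) := by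
    refine tendsto_nhdsWithin_iff.2 ⟨(tendsto_rpow_neg_atTop (by norm_num)).comp
      tendsto_natCast_atTop_atTop, ?_⟩
    filter_upwards [eventually_gt_atTop 0] with n hn
    exact Real.rpow_pos_of_pos (by exact_mod_cast hn) _
  have hsin : ∀ a : ℝ, Tendsto (fun n : ℕ => ((n : ℝ) ^ (-(1 / 4) : ℝ))⁻¹ *
      Real.sin (a * (n : ℝ) ^ (-(1 / 4) : ℝ))) atTop (𝓝 a) := fun a => by
    have h : HasDerivAt (fun t : ℝ => Real.sin (a * t)) a 0 := by
      have := (((hasDerivAt_id (0 : ℝ)).const_mul a)).sin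
      simpa using this
    have := h.tendsto_slope_zero_right.comp ht
    simpa [Function.comp_def] using this
  have hcos : ∀ c, Tendsto (fun n : ℕ => Real.sqrt n *
      (Real.cos (Real.sqrt d * (n : ℝ) ^ (-(1 / 4) : ℝ) * k c) - 1)) atTop
        (𝓝 (-2 * (Real.sqrt d * k c / 2) ^ 2)) := fun c => by
    refine (((hsin (Real.sqrt d * k c / 2)).pow 2).const_mul (-2)).congr' ?_
    filter_upwards [eventually_gt_atTop 0] with n hn
    have hn' : (0 : ℝ) < n := by exact_mod_cast hn
    have h1 : (((n : ℝ) ^ (-(1 / 4) : ℝ))⁻¹) ^ 2 = Real.sqrt n := by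
      rw [← Real.rpow_neg hn'.le, ← Real.rpow_natCast, ← Real.rpow_mul hn'.le,
        Real.sqrt_eq_rpow]
      norm_num
    have h2 : Real.cos (Real.sqrt d * (n : ℝ) ^ (-(1 / 4) : ℝ) * k c) =
        1 - 2 * Real.sin (Real.sqrt d * k c / 2 * (n : ℝ) ^ (-(1 / 4) : ℝ)) ^ 2 := by
      rw [← Real.cos_two_mul_eq_one_sub]
      congr 1
      ring
    rw [mul_pow, h1, h2]
    ring
  have hsum := (tendsto_finsetSum Finset.univ fun c _ => hcos c).div_const (d : ℝ)
  have hlim : (∑ c, -2 * (Real.sqrt d * k c / 2) ^ 2) / d = -‖k‖ ^ 2 / 2 := by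
    rw [EuclideanSpace.real_norm_sq_eq, Finset.sum_div, neg_div, Finset.sum_div,
      ← Finset.sum_neg_distrib]
    refine Finset.sum_congr rfl fun c _ => ?_
    rw [div_pow, mul_pow, Real.sq_sqrt (Nat.cast_nonneg d)]
    field_simp
  rw [hlim] at hsum
  refine hsum.congr fun n => ?_
  rw [← Finset.mul_sum, Finset.sum_sub_distrib, stepChar]
  simp only [PiLp.smul_apply, smul_eq_mul, Finset.sum_const, Finset.card_univ, Fintype.card_fin,
    nsmul_eq_mul, mul_one]
  field_simp

open Filter Topology in
theorem tendsto_stepChar_pow {d : ℕ} (hd : 1 ≤ d) (k : EuclideanSpace ℝ (Fin d)) {u : ℝ}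
    (hu : 0 ≤ u) :
    Tendsto (fun n : ℕ => stepChar ((Real.sqrt (d : ℝ) * (n : ℝ) ^ (-(1 / 4) : ℝ)) • k) ^
      ⌊u * Real.sqrt n⌋₊) atTop (𝓝 (Real.exp (-(‖k‖ ^ 2 * u) / 2))) := by
  have h := tendsto_sqrt_mul_stepChar_sub_one hd k
  have hinv : Tendsto (fun n : ℕ => (Real.sqrt n)⁻¹) atTop (𝓝 0) :=
    (Real.tendsto_sqrt_atTop.comp tendsto_natCast_atTop_atTop).inv_tendsto_atTop
  have hs : ∀ᶠ n : ℕ in atTop, Real.sqrt n ≠ 0 := by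
    filter_upwards [eventually_gt_atTop 0] with n hn
    exact (Real.sqrt_pos.2 (by exact_mod_cast hn)).ne'
  have h0 : Tendsto (fun n : ℕ =>
      stepChar ((Real.sqrt (d : ℝ) * (n : ℝ) ^ (-(1 / 4) : ℝ)) • k) - 1) atTop (𝓝 0) := by
    have := hinv.mul h
    rw [zero_mul] at this
    refine this.congr' ?_
    filter_upwards [hs] with n hn
    field_simp
  have h1 : Tendsto (fun n : ℕ => (⌊u * Real.sqrt n⌋₊ : ℝ) *
      (stepChar ((Real.sqrt (d : ℝ) * (n : ℝ) ^ (-(1 / 4) : ℝ)) • k) - 1)) atTop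
        (𝓝 (-(‖k‖ ^ 2 * u) / 2)) := by
    have := (tendsto_floor_div hu).mul h
    rw [show u * (-‖k‖ ^ 2 / 2) = -(‖k‖ ^ 2 * u) / 2 by ring] at this
    refine this.congr' ?_
    filter_upwards [hs] with n hn
    field_simp
  simpa using tendsto_one_add_pow h0 h1

open Filter Topology in
theorem tendsto_mul_scaledMPoint {d : ℕ} (hd : 1 ≤ d) {m : ℕ} (σ : Shape m)
    (k : Fin (2 * m - 3) → EuclideanSpace ℝ (Fin d)) (u : Fin (2 * m - 3) → ℝ)
    (hu : ∀ j, 0 ≤ u j) :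
    Tendsto (fun n : ℕ => (n : ℂ) * scaledMPoint d m n σ k u) atTop
      (𝓝 ((1 / Real.sqrt (2 * Real.pi) * aHat k u : ℝ) : ℂ)) := by
  let s : ℕ → Fin (2 * m - 3) → ℕ := fun n j => ⌊u j * Real.sqrt n⌋₊
  -- The `1` counts the root, and vanishes after division by `√n`.
  let b : ℕ → ℕ := fun n => ∑ j, s n j + 1
  have hinv : Tendsto (fun n : ℕ => (Real.sqrt n)⁻¹) atTop (𝓝 0) :=
    (Real.tendsto_sqrt_atTop.comp tendsto_natCast_atTop_atTop).inv_tendsto_atTop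
  have hb : Tendsto (fun n => (b n : ℝ) / Real.sqrt n) atTop (𝓝 (∑ j, u j)) := by
    have := (tendsto_finsetSum Finset.univ fun j _ => tendsto_floor_div (hu j)).add hinv
    rw [add_zero] at this
    refine this.congr fun n => ?_
    simp only [b, s]
    push_cast
    rw [add_div, Finset.sum_div, one_div]
  -- The exact formula needs `b n ≤ n`, which holds eventually because `b n` is of order at most
  -- `√n`.
  have hbn : ∀ᶠ n in atTop, b n ≤ n := by
    have h0 := hb.mul hinv
    rw [mul_zero] at h0
    filter_upwards [h0.eventually_lt_const one_pos, eventually_gt_atTop 0] with n hn hpos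
    have hpos' : (0 : ℝ) < n := by exact_mod_cast hpos
    rw [← div_eq_mul_inv, div_div, Real.mul_self_sqrt hpos'.le, div_lt_one hpos'] at hn
    exact_mod_cast hn.le
  have hmain := ((hb.mul (tendsto_descFactorial_div_pow hb)).mul tendsto_stirling).mul
    (tendsto_finsetProd Finset.univ fun j _ => tendsto_stepChar_pow hd (k j) (hu j))
  have hlim : (∑ j, u j) * Real.exp (-(∑ j, u j) ^ 2 / 2) * (1 / Real.sqrt (2 * Real.pi)) *
      ∏ j, Real.exp (-(‖k j‖ ^ 2 * u j) / 2) = 1 / Real.sqrt (2 * Real.pi) * aHat k u := by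
    rw [aHat]
    ring
  rw [hlim] at hmain
  refine ((Complex.continuous_ofReal.tendsto _).comp hmain).congr' ?_
  filter_upwards [hbn] with n hn
  have hcard : Nat.card (IsEdgeTree.Bond (s n)) = b n := IsEdgeTree.card_bond _
  have := copyWeight_eq (σ.isEdgeTree.isRootedTree_bondParent (s n)) (hcard ▸ hn)
  rw [hcard] at this
  rw [Function.comp_apply, scaledMPoint, mPointFourier_eq hd, ← this]
  push_cast
  rw [mul_assoc]

end MeanFieldTree

theorem lemma4p2 (d : ℕ) (hd : 1 ≤ d) (m : ℕ) (hm : 2 ≤ m) (σ : MeanFieldTree.Shape m)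
    (k : Fin (2 * m - 3) → EuclideanSpace ℝ (Fin d))
    (u : Fin (2 * m - 3) → ℝ) (hu : ∀ j, 0 ≤ u j) :
    Filter.Tendsto (fun n : ℕ => (n : ℂ) * MeanFieldTree.scaledMPoint d m n σ k u) Filter.atTop
      (nhds (((1 / Real.sqrt (2 * Real.pi) * MeanFieldTree.aHat k u : ℝ)) : ℂ)) ∧
    ((∃ j, u j ≠ 0) →
      Filter.Tendsto
        (fun n : ℕ => MeanFieldTree.scaledMPoint d m n σ k u /
          ((1 / Real.sqrt (2 * Real.pi) * (1 / (n : ℝ)) * MeanFieldTree.aHat k u : ℝ) : ℂ))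
        Filter.atTop (nhds 1)) := by
  have main := MeanFieldTree.tendsto_mul_scaledMPoint hd σ k u hu
  refine ⟨main, fun ⟨j, hj⟩ => ?_⟩
  have hsum : 0 < ∑ j, u j :=
    Finset.sum_pos' (fun j _ => hu j) ⟨j, Finset.mem_univ j, lt_of_le_of_ne (hu j) hj.symm⟩
  -- The limit vanishes only through the factor `∑ u j`, so the asymptotic equivalence follows on
  -- dividing by it.
  have hC : (1 / Real.sqrt (2 * Real.pi) * MeanFieldTree.aHat k u : ℝ) ≠ 0 := by
    have : 0 < MeanFieldTree.aHat k u :=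
      mul_pos (mul_pos hsum (Real.exp_pos _)) (Finset.prod_pos fun j _ => Real.exp_pos _)
    positivity
  have hC' : ((1 / Real.sqrt (2 * Real.pi) * MeanFieldTree.aHat k u : ℝ) : ℂ) ≠ 0 := by
    exact_mod_cast hC
  have h := main.div_const ((1 / Real.sqrt (2 * Real.pi) * MeanFieldTree.aHat k u : ℝ) : ℂ)
  rw [div_self hC'] at h
  refine h.congr' ?_
  filter_upwards [Filter.eventually_ne_atTop 0] with n hn
  have hn' : (n : ℂ) ≠ 0 := by exact_mod_cast hn
  rw [show 1 / Real.sqrt (2 * Real.pi) * (1 / (n : ℝ)) * MeanFieldTree.aHat k u =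
    1 / Real.sqrt (2 * Real.pi) * MeanFieldTree.aHat k u / n by ring, Complex.ofReal_div,
    Complex.ofReal_natCast, div_div_eq_mul_div, mul_comm]
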